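/- Let $\mathsf k$ be a commutative Noetherian ring, $Q$ a finite acyclic quiver with vertex set $Q_0$ and arrow set $Q_1$, and for each pair of vertices $v,v'$ let a family of disjoint sets of paths from $v$ to $v'$ be given. Paths are multiplied by concatenation ($pq$ means first $p$, then $q$). Let $I\subset \mathsf kQ$ be the two-sided ideal generated by all differences $p-p'$ of paths lying in a common set of these families, and suppose that $A=\mathsf kQ/I$ is a homotopy path algebra: for all paths $r,p,p'$, if $rp-rp'$ is nonzero and lies in $I$, then $p-p'\in I$; and if $pr-p'r$ is nonzero and lies in $I$, then $p-p'\in I$. Let $\mathcal C_A$ be the category with object set $Q_0$ whose morphisms $v\to v'$ are the paths from $v$ to $v'$ modulo $p\sim q\Leftrightarrow p-q\in I$, and let $X_A$ be its classifying space. Its $n$-cells are the nondegenerate $n$-simplices of the nerve of $\mathcal C_A$, i.e. strings $\sigma=(v_0\to v_1\to\dots\to v_n)$ of nonidentity morphisms; put $t(\sigma)=v_0$, $h(\sigma)=v_n$, and let $\partial_i\sigma$ be the facet omitting $v_i$. Write $e_v$ for the constant path at $v$ and $P_\sigma=Ae_{t(\sigma)}\otimes_{\mathsf k}e_{h(\sigma)}A$,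 a projective $(A,A)$-bimodule with generator $1\otimes[\sigma]\otimes1$. For a facet $\tau=\partial_i\sigma$ of an $n$-cell $\sigma$ put $[\sigma:\tau]=(-1)^i$; let $l(\sigma,\tau)\in A$ be the class of the first morphism $v_0\to v_1$ if $i=0$ and $1$ otherwise; let $r(\sigma,\tau)\in A$ be the class of the last morphism $v_{n-1}\to v_n$ if $i=n$ and $1$ otherwise. The cellular resolution of the diagonal bimodule $A$ is the complex $\mathsf C_\bullet$ with $\mathsf C_n=\bigoplus_{\sigma\ n\text{-cell}}P_\sigma$ and $$d(1\otimes[\sigma]\otimes1)=\sum_{\tau}[\sigma:\tau]\,l(\sigma,\tau)\otimes[\tau]\otimes r(\sigma,\tau),$$ the sum running over the facets $\tau$ of $\sigma$. A matching $M$ on $X_A$ is a set of pairs $(\sigma,\tau)$, with $\tau$ a facet of $\sigma$, in which every cell occurs at most once; cells that do not occur are called critical. Orient the Hasse diagram of the cell poset so that the edge of a matched pair points from $\tau$ up to $\sigma$ and every other edge points down; $M$ is acyclic if there are no oriented cycles. $M$ is internal if the cells given by $Q_0$ and $Q_1$ are critical and $t(\sigma)=t(\tau)$, $h(\sigma)=h(\tau)$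 for every $(\sigma,\tau)\in M$. For an acyclic internal matching $M$, a gradient path $\gamma$ from an $n$-cell $\sigma$ to an $(n-1)$-cell $\tau$ is an oriented path $$\sigma=\sigma_0\searrow\rho_1\nearrow\sigma_1\searrow\rho_2\nearrow\dots\nearrow\sigma_m\searrow\rho_{m+1}=\tau\qquad(m\ge 0)$$ in the oriented Hasse diagram, alternating between downward and upward edges. Put $$\epsilon(\gamma)=\prod_{i=0}^m[\sigma_i:\rho_{i+1}]\cdot\prod_{i=1}^m\bigl(-[\sigma_i:\rho_i]\bigr),$$ $$l(\gamma)=l(\sigma_0,\rho_1)\,l(\sigma_1,\rho_2)\cdots l(\sigma_m,\rho_{m+1}),\qquad r(\gamma)=r(\sigma_m,\rho_{m+1})\cdots r(\sigma_1,\rho_2)\,r(\sigma_0,\rho_1).$$ The Morse complex $\mathfrak C_\bullet$ of projective bimodules has $\mathfrak C_n=\bigoplus_{\sigma\text{ critical }n\text{-cell}}P_\sigma$ and $$\delta(1\otimes[\sigma]\otimes1)=\sum_{\tau\text{ critical}}\ \sum_{\gamma:\sigma\to\tau}\epsilon(\gamma)\,l(\gamma)\otimes[\tau]\otimes r(\gamma).$$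 Then $\mathsf C_\bullet$ and $\mathfrak C_\bullet$ are chain complexes of $(A,A)$-bimodules, and $\mathfrak C_\bullet$ is quasi-isomorphic to $\mathsf C_\bullet$: there is a quasi-isomorphism of complexes of bimodules $\mathsf C_\bullet\to\mathfrak C_\bullet$. Moreover $\mathfrak C_\bullet$, whose summands are indexed by the critical cells only, is a projective resolution of the diagonal bimodule $A$: each $\mathfrak C_n$ is a projective bimodule, and the multiplication map $\mathfrak C_0=\bigoplus_{v\in Q_0}Ae_v\otimes_{\mathsf k}e_vA\to A$ induces a quasi-isomorphism $\mathfrak C_\bullet\to A$. -/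

import Mathlib

open CategoryTheory Opposite
open scoped TensorProduct DirectSum

noncomputable section

namespace HomotopyPath

universe u v w

/-! ### Path algebras of quivers -/

/-- The set of all paths of a quiver `Q` (including the constant path `e_v` at each vertex `v`). -/
abbrev AllPaths (Q : Type u) [Quiver.{v} Q] := Σ (a b : Q), Quiver.Path a b

/-- The path algebra `kQ`: the free `k`-module on the set of all paths, with multiplication
given by concatenation: `p * q` is the path "first `p`, then `q`" if `p` ends where `q` starts,
and `0` otherwise. -/
def PathAlgebra (k : Type w) (Q : Type u) [CommRing k] [Quiver.{v} Q] := AllPaths Q →₀ k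

namespace PathAlgebra

variable {k : Type w} {Q : Type u} [CommRing k] [Quiver.{v} Q]

instance addCommGroup : AddCommGroup (PathAlgebra k Q) := inferInstanceAs (AddCommGroup (AllPaths Q →₀ k))

instance : Module k (PathAlgebra k Q) := inferInstanceAs (Module k (AllPaths Q →₀ k))

/-- The basis element of `kQ` given by a path. -/
def ofPath (k : Type w) {Q : Type u} [CommRing k] [Quiver.{v} Q] (p : AllPaths Q) :
    PathAlgebra k Q :=
  Finsupp.single p (1 : k)

open Classical in
/-- The product of two paths. -/
def mulPath (k : Type w) {Q : Type u} [CommRing k] [Quiver.{v} Q] (p q : AllPaths Q) :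
    PathAlgebra k Q :=
  if h : q.1 = p.2.1 then ofPath k ⟨p.1, q.2.1, p.2.2.comp (q.2.2.cast h rfl)⟩ else 0

/-- The bilinear extension of the product of paths. -/
def mulLin : PathAlgebra k Q →ₗ[k] PathAlgebra k Q →ₗ[k] PathAlgebra k Q :=
  Finsupp.linearCombination k (fun p : AllPaths Q =>
    (Finsupp.linearCombination k (fun q : AllPaths Q => mulPath k p q) :
      PathAlgebra k Q →ₗ[k] PathAlgebra k Q))

instance : Mul (PathAlgebra k Q) := ⟨fun x y => mulLin x y⟩

instance [Fintype Q] : One (PathAlgebra k Q) := ⟨∑ x : Q, ofPath k ⟨x, x, Quiver.Path.nil⟩⟩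

theorem mul_def (x y : PathAlgebra k Q) : x * y = mulLin x y := rfl

theorem one_def [Fintype Q] :
    (1 : PathAlgebra k Q) = ∑ x : Q, ofPath k ⟨x, x, Quiver.Path.nil⟩ := rfl

theorem ofPath_mul (p q : AllPaths Q) : ofPath k p * ofPath k q = mulPath k p q := by
  rw [mul_def]
  unfold mulLin ofPath
  erw [Finsupp.linearCombination_single, one_smul, Finsupp.linearCombination_single, one_smul]

theorem ofPath_mul_of_eq {a b c : Q} (p : Quiver.Path a b) (q : Quiver.Path b c) :
    ofPath k ⟨a, b, p⟩ * ofPath k ⟨b, c, q⟩ = ofPath k ⟨a, c, p.comp q⟩ := by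
  rw [ofPath_mul]
  simp [mulPath]

theorem ofPath_mul_of_ne {p q : AllPaths Q} (h : q.1 ≠ p.2.1) :
    ofPath k p * ofPath k q = 0 := by
  rw [ofPath_mul]
  simp [mulPath, h]

theorem induction {P : PathAlgebra k Q → Prop} (x : PathAlgebra k Q) (zero : P 0)
    (add : ∀ x y, P x → P y → P (x + y)) (smul : ∀ (c : k) p, P (c • ofPath k p)) : P x := by
  refine Finsupp.induction_linear (motive := P) x zero add fun p c => ?_
  have : (Finsupp.single p c : PathAlgebra k Q) = c • ofPath k p := by
    unfold ofPath
    erw [Finsupp.smul_single, smul_eq_mul, mul_one]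
  rw [this]
  exact smul c p

theorem smul_mul' (c : k) (x y : PathAlgebra k Q) : c • x * y = c • (x * y) := by
  simp [mul_def]

theorem mul_smul' (c : k) (x y : PathAlgebra k Q) : x * c • y = c • (x * y) := by
  simp [mul_def]

theorem add_mul' (x y z : PathAlgebra k Q) : (x + y) * z = x * z + y * z := by
  simp [mul_def]

theorem mul_add' (x y z : PathAlgebra k Q) : x * (y + z) = x * y + x * z := by
  simp [mul_def]

theorem zero_mul' (x : PathAlgebra k Q) : 0 * x = 0 := by
  simp [mul_def]

theorem mul_zero' (x : PathAlgebra k Q) : x * 0 = 0 := by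
  simp [mul_def]

theorem mul_assoc' (x y z : PathAlgebra k Q) : x * y * z = x * (y * z) := by
  induction x using induction with
  | zero => simp [zero_mul']
  | add x x' hx hx' => simp only [add_mul', hx, hx']
  | smul c p =>
  induction y using induction with
  | zero => simp [zero_mul', mul_zero']
  | add x x' hx hx' => simp only [add_mul', mul_add', hx, hx']
  | smul c' q =>
  induction z using induction with
  | zero => simp [mul_zero']
  | add x x' hx hx' => simp only [mul_add', hx, hx']
  | smul c'' r =>
  simp only [smul_mul', mul_smul']
  congr 3
  obtain ⟨a, b, p⟩ := p
  obtain ⟨b', c, q⟩ := q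
  obtain ⟨c', d, r⟩ := r
  by_cases h : b' = b
  · subst h
    rw [ofPath_mul_of_eq]
    by_cases h' : c' = c
    · subst h'
      rw [ofPath_mul_of_eq, ofPath_mul_of_eq, ofPath_mul_of_eq, Quiver.Path.comp_assoc]
    · rw [ofPath_mul_of_ne h', ofPath_mul_of_ne h', mul_zero']
  · rw [ofPath_mul_of_ne h, zero_mul']
    by_cases h' : c' = c
    · subst h'
      rw [ofPath_mul_of_eq, ofPath_mul_of_ne h]
    · rw [ofPath_mul_of_ne (p := ⟨b', c, q⟩) h', mul_zero']

theorem one_mul' [Fintype Q] (x : PathAlgebra k Q) : 1 * x = x := by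
  induction x using induction with
  | zero => simp [mul_zero']
  | add x x' hx hx' => simp only [mul_add', hx, hx']
  | smul c p =>
  rw [mul_smul']
  congr 1
  obtain ⟨a, b, p⟩ := p
  rw [one_def, mul_def, map_sum, LinearMap.sum_apply, Finset.sum_eq_single a]
  · rw [← mul_def, ofPath_mul_of_eq, Quiver.Path.nil_comp]
  · intro y _ hy
    rw [← mul_def, ofPath_mul_of_ne]
    exact hy.symm
  · simp

theorem mul_one' [Fintype Q] (x : PathAlgebra k Q) : x * 1 = x := by
  induction x using induction with
  | zero => simp [zero_mul']
  | add x x' hx hx' => simp only [add_mul', hx, hx']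
  | smul c p =>
  rw [smul_mul']
  congr 1
  obtain ⟨a, b, p⟩ := p
  rw [one_def, mul_def, map_sum, Finset.sum_eq_single b]
  · rw [← mul_def, ofPath_mul_of_eq, Quiver.Path.comp_nil]
  · intro y _ hy
    rw [← mul_def, ofPath_mul_of_ne]
    exact hy
  · simp

instance [Fintype Q] : Ring (PathAlgebra k Q) where
  __ := addCommGroup (k := k) (Q := Q)
  mul := (· * ·)
  one := 1
  left_distrib := mul_add'
  right_distrib := add_mul'
  zero_mul := zero_mul'
  mul_zero := mul_zero'
  mul_assoc := mul_assoc'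
  one_mul := one_mul'
  mul_one := mul_one'

instance [Fintype Q] : Algebra k (PathAlgebra k Q) := Algebra.ofModule smul_mul' mul_smul'

end PathAlgebra

/-! ### Homotopy path algebras -/

/-- For each ordered pair of vertices, a collection of disjoint sets of parallel paths between
them.  Two paths in a common set will be identified. -/
structure PathRelations (Q : Type u) [Quiver.{v} Q] where
  /-- the sets of paths from `a` to `b` -/
  blocks : ∀ a b : Q, Set (Set (Quiver.Path a b))
  disjoint : ∀ a b : Q, (blocks a b).PairwiseDisjoint id

/-- A quiver is acyclic if it has no nonconstant closed path. -/
def IsAcyclicQuiver (Q : Type u) [Quiver.{v} Q] : Prop :=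
  ∀ (a : Q) (p : Quiver.Path a a), p = Quiver.Path.nil

variable (k : Type w) [CommRing k] {Q : Type u} [Quiver.{v} Q] [Fintype Q] (S : PathRelations Q)

/-- The two-sided ideal `I_S` of `kQ` generated by the differences `p - p'` of paths lying in a
common block of `S`. -/
def relIdeal : TwoSidedIdeal (PathAlgebra k Q) :=
  TwoSidedIdeal.span
    {x | ∃ (a b : Q) (B : Set (Quiver.Path a b)) (p p' : Quiver.Path a b),
      B ∈ S.blocks a b ∧ p ∈ B ∧ p' ∈ B ∧
      x = PathAlgebra.ofPath k ⟨a, b, p⟩ - PathAlgebra.ofPath k ⟨a, b, p'⟩}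

/-- The algebra `A = kQ / I_S`. -/
def QuotAlg := (relIdeal k S).ringCon.Quotient

instance : Ring (QuotAlg k S) := inferInstanceAs (Ring (relIdeal k S).ringCon.Quotient)

instance : Algebra k (QuotAlg k S) :=
  inferInstanceAs (Algebra k (relIdeal k S).ringCon.Quotient)

/-- The condition for `A = kQ / I_S` to be a homotopy path algebra. -/
structure IsHPA : Prop where
  cancel_left : ∀ r p p' : AllPaths Q,
    PathAlgebra.ofPath k r * PathAlgebra.ofPath k p
      - PathAlgebra.ofPath k r * PathAlgebra.ofPath k p' ≠ 0 →
    PathAlgebra.ofPath k r * PathAlgebra.ofPath k p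
      - PathAlgebra.ofPath k r * PathAlgebra.ofPath k p' ∈ relIdeal k S →
    PathAlgebra.ofPath k p - PathAlgebra.ofPath k p' ∈ relIdeal k S
  cancel_right : ∀ r p p' : AllPaths Q,
    PathAlgebra.ofPath k p * PathAlgebra.ofPath k r
      - PathAlgebra.ofPath k p' * PathAlgebra.ofPath k r ≠ 0 →
    PathAlgebra.ofPath k p * PathAlgebra.ofPath k r
      - PathAlgebra.ofPath k p' * PathAlgebra.ofPath k r ∈ relIdeal k S →
    PathAlgebra.ofPath k p - PathAlgebra.ofPath k p' ∈ relIdeal k S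

/-- The class in `A` of a path. -/
def pathClass (p : AllPaths Q) : QuotAlg k S := (relIdeal k S).ringCon.mk' (PathAlgebra.ofPath k p)

/-- The idempotent `e_a` of `A`. -/
def idem (a : Q) : QuotAlg k S := pathClass k S ⟨a, a, Quiver.Path.nil⟩

/-- Two parallel paths are equivalent if their difference lies in `I_S`. -/
def pathRel : HomRel (Paths Q) := fun a b p p' =>
  PathAlgebra.ofPath k (⟨a, b, p⟩ : AllPaths Q) - PathAlgebra.ofPath k (⟨a, b, p'⟩ : AllPaths Q)
    ∈ relIdeal k S

/-- The category `C_A`: the objects are the vertices of `Q`, the morphisms are equivalence classes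
of paths, and composition is concatenation. -/
abbrev PathCat := CategoryTheory.Quotient (pathRel k S)

theorem pathClass_eq_of_compClosure {x y : Paths Q} {s t : x ⟶ y}
    (h : HomRel.CompClosure (pathRel k S) s t) :
    pathClass k S ⟨x, y, s⟩ = pathClass k S ⟨x, y, t⟩ := by
  obtain ⟨a, b, f, p, p', g, h⟩ := h
  refine (RingCon.eq _).2 ((TwoSidedIdeal.rel_iff _ _ _).2 ?_)
  have key : ∀ q : a ⟶ b,
      PathAlgebra.ofPath k (⟨x, y, f ≫ q ≫ g⟩ : AllPaths Q) =
        PathAlgebra.ofPath k (⟨x, a, f⟩ : AllPaths Q) *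
          (PathAlgebra.ofPath k (⟨a, b, q⟩ : AllPaths Q) *
            PathAlgebra.ofPath k (⟨b, y, g⟩ : AllPaths Q)) := by
    intro q
    erw [PathAlgebra.ofPath_mul_of_eq, PathAlgebra.ofPath_mul_of_eq]
    rfl
  rw [key, key, ← mul_sub, ← sub_mul]
  exact (relIdeal k S).mul_mem_left _ _ ((relIdeal k S).mul_mem_right _ _ h)

/-- The element of `A` given by a morphism of `C_A`. -/
def homClass {X Y : PathCat k S} (f : X ⟶ Y) : QuotAlg k S :=
  Quot.lift (fun p : (X.as ⟶ Y.as) => pathClass k S ⟨X.as, Y.as, p⟩)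
    (fun _ _ h => pathClass_eq_of_compClosure k S h) f

/-! ### Cells of the geometric realization -/

/-- The `n`-cells of the geometric realization `X_A`, the classifying space of `C_A`: these are the
nondegenerate `n`-simplices of the nerve of `C_A`, i.e. the strings of `n` composable nonidentity
morphisms. -/
@[ext]
structure Cell (n : ℕ) where
  /-- the string of composable morphisms -/
  arrows : ComposableArrows (PathCat k S) n
  nonDegenerate : arrows ∈ (nerve (PathCat k S)).nonDegenerate n

variable {k S}

namespace Cell

/-- The starting vertex `t(σ)`. -/
def start {n : ℕ} (σ : Cell k S n) : Q := (σ.arrows.obj 0).as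

/-- The final vertex `h(σ)`. -/
def finish {n : ℕ} (σ : Cell k S n) : Q := (σ.arrows.obj (Fin.last n)).as

/-- The `i`-th face of a cell, obtained by omitting the `i`-th vertex. -/
def face {n : ℕ} (i : Fin (n + 2)) (σ : Cell k S (n + 1)) :
    ComposableArrows (PathCat k S) n :=
  (nerve (PathCat k S)).δ i σ.arrows

/-- The left coefficient attached to omitting the `i`-th vertex: the first morphism of the string
if `i = 0`, and `1` otherwise. -/
def leftCoeff {n : ℕ} (i : Fin (n + 2)) (σ : Cell k S (n + 1)) : QuotAlg k S :=
  if i = 0 then homClass k S (σ.arrows.map' 0 1) else 1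

/-- The right coefficient attached to omitting the `i`-th vertex: the last morphism of the string
if `i` is the last vertex, and `1` otherwise. -/
def rightCoeff {n : ℕ} (i : Fin (n + 2)) (σ : Cell k S (n + 1)) : QuotAlg k S :=
  if i = Fin.last (n + 1) then homClass k S (σ.arrows.map' n (n + 1)) else 1

end Cell

/-! ### Bimodules -/

variable (k S)

/-- The enveloping algebra `A ⊗ Aᵒᵖ`; its left modules are the `(A, A)`-bimodules. -/
def Env := QuotAlg k S ⊗[k] (QuotAlg k S)ᵐᵒᵖ

instance : Ring (Env k S) := inferInstanceAs (Ring (QuotAlg k S ⊗[k] (QuotAlg k S)ᵐᵒᵖ))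

instance : Algebra k (Env k S) :=
  inferInstanceAs (Algebra k (QuotAlg k S ⊗[k] (QuotAlg k S)ᵐᵒᵖ))

variable {k S} in
/-- The element `l ⊗ r` of `A ⊗ Aᵒᵖ`. -/
def Env.tmul (l r : QuotAlg k S) : Env k S := l ⊗ₜ[k] MulOpposite.op r

/-- The diagonal bimodule `A`: the element `a ⊗ b` acts by `x ↦ a * x * b`. -/
instance : Module (Env k S) (QuotAlg k S) :=
  Module.compHom _ (AlgHom.mulLeftRight k (QuotAlg k S) : Env k S →ₐ[k] Module.End k (QuotAlg k S)).toRingHom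

/-- The element `e_a ⊗ e_b` of `A ⊗ Aᵒᵖ`. -/
def envIdem (a b : Q) : Env k S := Env.tmul (idem k S a) (idem k S b)

/-- The bimodule `P_a ⊠ P_bᵒᵖ = A e_a ⊗ e_b A`, i.e. the left ideal of `A ⊗ Aᵒᵖ` generated by
`e_a ⊗ e_b`. -/
def boxProj (a b : Q) : Submodule (Env k S) (Env k S) := Submodule.span _ {envIdem k S a b}

variable {k S}

/-- The bimodule map `P_a ⊠ P_bᵒᵖ → P_a' ⊠ P_b'ᵒᵖ` with `1 ⊗ 1 ↦ l ⊗ r`, where `1 ⊗ 1` stands for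
the generators and `l ⊗ r` for the action of `l` from the left and `r` from the right. -/
def boxMap (a b a' b' : Q) (l r : QuotAlg k S) : boxProj k S a b →ₗ[Env k S] boxProj k S a' b' :=
  ((LinearMap.toSpanSingleton (Env k S) (Env k S)
      (Env.tmul l r * envIdem k S a' b')).comp
    (boxProj k S a b).subtype).codRestrict _ (fun x => by
      have h : envIdem k S a' b' ∈ boxProj k S a' b' := Submodule.subset_span rfl
      have := (boxProj k S a' b').smul_mem ((x : Env k S) * Env.tmul l r) h
      simpa [mul_assoc] using this)

/-- The bimodule `P_σ = P_{t(σ)} ⊠ P_{h(σ)}ᵒᵖ` of a cell. -/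
abbrev Cell.proj {n : ℕ} (σ : Cell k S n) : Submodule (Env k S) (Env k S) :=
  boxProj k S σ.start σ.finish

/-- The bimodule map `P_σ → P_τ` with `1 ⊗ [σ] ⊗ 1 ↦ l ⊗ [τ] ⊗ r`. -/
abbrev Cell.projMap {m n : ℕ} (σ : Cell k S m) (τ : Cell k S n) (l r : QuotAlg k S) :
    σ.proj →ₗ[Env k S] τ.proj :=
  boxMap σ.start σ.finish τ.start τ.finish l r

/-- The multiplication map `P_a ⊠ P_bᵒᵖ → A`, `x ⊗ y ↦ x * y`. -/
def boxMul (a b : Q) : boxProj k S a b →ₗ[Env k S] QuotAlg k S :=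
  (LinearMap.toSpanSingleton (Env k S) (QuotAlg k S) 1).comp (boxProj k S a b).subtype

/-! ### The cellular resolution -/

variable (k S)

/-- `C_n`, the direct sum of the bimodules `P_σ` over all `n`-cells. -/
abbrev CellularModule (n : ℕ) := ⨁ σ : Cell k S n, σ.proj

open Classical in
/-- The differential `d_{n+1} = ∑ i, (-1) ^ i ∂_i : C_{n+1} → C_n`.
(Faces of cells are always cells when the quiver is acyclic, so the second case is never used.) -/
def cellularD (n : ℕ) : CellularModule k S (n + 1) →ₗ[Env k S] CellularModule k S n :=
  DirectSum.toModule _ _ _ fun σ => ∑ i : Fin (n + 2),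
    if h : σ.face i ∈ (nerve (PathCat k S)).nonDegenerate n then
      ((-1 : ℤ) ^ (i : ℕ)) •
        (DirectSum.lof (Env k S) _ (fun τ : Cell k S n => τ.proj) ⟨σ.face i, h⟩).comp
          (σ.projMap (⟨σ.face i, h⟩ : Cell k S n) (σ.leftCoeff i) (σ.rightCoeff i))
    else 0

/-- The chain complex `C_•` of bimodules. -/
def cellularComplex (h : ∀ n, (cellularD k S n).comp (cellularD k S (n + 1)) = 0) :
    ChainComplex (ModuleCat (Env k S)) ℕ :=
  ChainComplex.of (fun n => ModuleCat.of (Env k S) (CellularModule k S n))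
    (fun n => ModuleCat.ofHom (cellularD k S n))
    (fun n => by rw [← ModuleCat.ofHom_comp, h n]; rfl)

/-! ### Matchings -/

/-- A matching on the cells of `X_A`: a set of pairs of a cell and one of its facets, in which
every cell occurs at most once. -/
structure Matching where
  /-- `pair σ τ` means that `σ` is matched with its facet `τ`. -/
  pair : ∀ {n : ℕ}, Cell k S (n + 1) → Cell k S n → Prop
  facet : ∀ {n : ℕ} {σ : Cell k S (n + 1)} {τ : Cell k S n}, pair σ τ → ∃ i, σ.face i = τ.arrows
  bottom_unique : ∀ {n : ℕ} {σ : Cell k S (n + 1)} {τ τ' : Cell k S n},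
    pair σ τ → pair σ τ' → τ = τ'
  top_unique : ∀ {n : ℕ} {σ σ' : Cell k S (n + 1)} {τ : Cell k S n},
    pair σ τ → pair σ' τ → σ = σ'
  top_bottom_disjoint : ∀ {n : ℕ} {ρ : Cell k S (n + 2)} {σ : Cell k S (n + 1)} {τ : Cell k S n},
    pair ρ σ → ¬ pair σ τ

namespace Matching

variable {k S} (M : Matching k S)

/-- `σ` is the larger cell of a matched pair. -/
def IsTop {n : ℕ} (σ : Cell k S n) : Prop :=
  match n, σ with
  | 0, _ => False
  | _ + 1, σ => ∃ τ, M.pair σ τ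

/-- `σ` is the smaller cell of a matched pair. -/
def IsBottom {n : ℕ} (σ : Cell k S n) : Prop := ∃ ρ, M.pair ρ σ

/-- A cell is critical if it is unmatched. -/
def IsCritical {n : ℕ} (σ : Cell k S n) : Prop := ¬ M.IsTop σ ∧ ¬ M.IsBottom σ

/-- The arrows of the Hasse diagram of cells, oriented by the matching: from a cell down to each
facet it is not matched with, and up from the smaller to the larger cell of a matched pair. -/
inductive Arrow : (Σ n, Cell k S n) → (Σ n, Cell k S n) → Prop
  | down {n : ℕ} (σ : Cell k S (n + 1)) (τ : Cell k S n) (i : Fin (n + 2))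
      (h : σ.face i = τ.arrows) (hM : ¬ M.pair σ τ) : Arrow ⟨n + 1, σ⟩ ⟨n, τ⟩
  | up {n : ℕ} (σ : Cell k S (n + 1)) (τ : Cell k S n) (hM : M.pair σ τ) :
      Arrow ⟨n, τ⟩ ⟨n + 1, σ⟩

/-- A matching is acyclic if the oriented Hasse diagram has no oriented cycles. -/
def IsAcyclic : Prop := ∀ c : Σ n, Cell k S n, ¬ Relation.TransGen M.Arrow c c

/-- A matching is internal if the cells given by vertices and arrows of `Q` are unmatched, and
matched cells have the same starting vertex and the same final vertex. -/
structure IsInternal : Prop where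
  vertex_unmatched : ∀ σ : Cell k S 0, M.IsCritical σ
  arrow_unmatched : ∀ {a b : Q} (f : a ⟶ b) (σ : Cell k S 1),
    σ.arrows = ComposableArrows.mk₁ ((CategoryTheory.Quotient.functor (pathRel k S)).map
      ((Paths.of Q).map f)) → M.IsCritical σ
  start_eq : ∀ {n : ℕ} {σ : Cell k S (n + 1)} {τ : Cell k S n}, M.pair σ τ → σ.start = τ.start
  finish_eq : ∀ {n : ℕ} {σ : Cell k S (n + 1)} {τ : Cell k S n}, M.pair σ τ → σ.finish = τ.finish

/-- Gradient paths from an `(n+1)`-cell `σ` to an `n`-cell `τ`: alternating sequences of downward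
and upward arrows of the oriented Hasse diagram that start with a downward arrow at `σ` and end with
a downward arrow to `τ`.  Each arrow is recorded with the index of the vertex that is omitted. -/
inductive GradientPath {n : ℕ} (τ : Cell k S n) : Cell k S (n + 1) → Type (max u v)
  | last {σ : Cell k S (n + 1)} (i : Fin (n + 2)) (h : σ.face i = τ.arrows) (hM : ¬ M.pair σ τ) :
      GradientPath τ σ
  | step {σ σ' : Cell k S (n + 1)} (ρ : Cell k S n)
      (i : Fin (n + 2)) (h : σ.face i = ρ.arrows) (hM : ¬ M.pair σ ρ)
      (j : Fin (n + 2)) (h' : σ'.face j = ρ.arrows) (hM' : M.pair σ' ρ)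
      (γ : GradientPath τ σ') : GradientPath τ σ

namespace GradientPath

variable {M} {n : ℕ} {τ : Cell k S n}

/-- The multiplicity `ε(γ)` of discrete Morse theory: each downward arrow contributes its incidence
number, and each upward arrow contributes minus its incidence number. -/
def sign : ∀ {σ : Cell k S (n + 1)}, M.GradientPath τ σ → ℤ
  | _, last i _ _ => (-1) ^ (i : ℕ)
  | _, step _ i _ _ j _ _ γ => (-1) ^ (i : ℕ) * (-(-1) ^ (j : ℕ)) * γ.sign

/-- The left coefficient `l(γ)`: the product of the initial morphisms that are cut off along the
downward arrows of `γ`. -/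
def left : ∀ {σ : Cell k S (n + 1)}, M.GradientPath τ σ → QuotAlg k S
  | σ, last i _ _ => σ.leftCoeff i
  | σ, step _ i _ _ _ _ _ γ => σ.leftCoeff i * γ.left

/-- The right coefficient `r(γ)`: the product of the terminal morphisms that are cut off along the
downward arrows of `γ`. -/
def right : ∀ {σ : Cell k S (n + 1)}, M.GradientPath τ σ → QuotAlg k S
  | σ, last i _ _ => σ.rightCoeff i
  | σ, step _ i _ _ _ _ _ γ => γ.right * σ.rightCoeff i

end GradientPath

/-- The direct sum of the bimodules `P_σ` over all critical `n`-cells. -/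
abbrev MorseModule (n : ℕ) := ⨁ σ : {σ : Cell k S n // M.IsCritical σ}, σ.1.proj

open Classical in
/-- The Morse differential `1 ⊗ [σ] ⊗ 1 ↦ ∑ τ, ∑ γ, ε(γ) l(γ) ⊗ [τ] ⊗ r(γ)`, the sums running over
the critical `n`-cells `τ` and the gradient paths `γ` from `σ` to `τ`.  (Both sums are finite
for an acyclic matching and a finite acyclic quiver.) -/
def morseD (n : ℕ) : M.MorseModule (n + 1) →ₗ[Env k S] M.MorseModule n :=
  DirectSum.toModule _ _ _ fun σ =>
    ∑ᶠ τ : {τ : Cell k S n // M.IsCritical τ}, ∑ᶠ γ : M.GradientPath τ.1 σ.1,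
      γ.sign •
        (DirectSum.lof (Env k S) _
          (fun τ : {τ : Cell k S n // M.IsCritical τ} => τ.1.proj) τ).comp
          (σ.1.projMap τ.1 γ.left γ.right)

/-- The Morse complex of bimodules. -/
def morseComplex (h : ∀ n, (M.morseD n).comp (M.morseD (n + 1)) = 0) :
    ChainComplex (ModuleCat (Env k S)) ℕ :=
  ChainComplex.of (fun n => ModuleCat.of (Env k S) (M.MorseModule n))
    (fun n => ModuleCat.ofHom (M.morseD n))
    (fun n => by rw [← ModuleCat.ofHom_comp, h n]; rfl)

open Classical in
/-- The augmentation to the diagonal bimodule `A`, given by multiplication. -/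
def augmentation : M.MorseModule 0 →ₗ[Env k S] QuotAlg k S :=
  DirectSum.toModule _ _ _ fun σ => boxMul σ.1.start σ.1.finish

end Matching

end HomotopyPath

end

open HomotopyPath

noncomputable section

namespace HomotopyPath

universe u v w x

/-! ### Nerves of acyclic categories -/

/-! Two mechanisms combine: a contraction of the cellular complex and algebraic discrete Morse
theory.

The contraction is that of a bar resolution: `p ⊗ [s] ⊗ r ↦ 1 ⊗ [p s] ⊗ r` puts the left coefficient
in front of the string. It exists because a linear map out of `A` may be prescribed on the morphisms
of `C_A` (`homLift`). Acyclicity of the quiver makes the objects of a cell distinct, so faces of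
cells are cells, and prepending `p` to a cell gives a cell exactly when `p` is not an identity. The
identities `contraction_identity` and `contraction_identity_zero` give exactness of the augmented
cellular complex; they also give `d² = 0` by induction, since generators of positive degree lie in
the image of the contraction.

For the Morse part (`MorseSplitting`), the matching splits the complex into a critical part, upper
cells `T` and lower cells `B`. Internality makes the coefficient of a matched facet `±1 ⊗ 1`
(`faceCoeff_eq_one`), so the component of `d` from `T` to `B`, after identifying `B` with `T` by
`up`, is the identity plus a perturbation that moves along the oriented Hasse diagram. With finitely
many cells and no oriented cycle, the perturbation is nilpotent (`isNilpotent_pert`). Inverting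
yields a homotopy `h` for which `1 - d h - h d` factors through the critical part. The projection to
the Morse complex is `π - flow ∘ up`, where `flow` sums over gradient paths; all that is needed
about it is the recursion obtained by cutting a path after its first downward arrow (`flowVal_eq`,
`flowMap_sub`). The key identities are tested on the critical part, on `T` and on `d (up x)`, which
together generate everything (`hom_eq_zero`).

Since all vertices are critical, the projection respects the augmentations in degree `0`, and
two-out-of-three gives the resolution of `A`. Projectivity holds because each summand is generated
by an idempotent. -/

/-- A category in which every endomorphism is an identity and in which two objects with morphisms
in both directions between them are equal. -/
structure IsAcyclicCategory (C : Type u) [Category.{v} C] : Prop where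
  hom_self : ∀ {X : C} (f : X ⟶ X), f = 𝟙 X
  antisymm : ∀ {X Y : C}, (X ⟶ Y) → (Y ⟶ X) → X = Y

section Nerve

variable {C : Type u} [Category.{v} C]

theorem IsAcyclicCategory.eq_eqToHom (hC : IsAcyclicCategory C) {X Y : C} (h : X = Y)
    (f : X ⟶ Y) : f = eqToHom h := by
  subst h
  exact hC.hom_self f

theorem functor_map_congr {n : ℕ} (F : Fin n ⥤ C) {a b a' b' : Fin n} (ha : a = a') (hb : b = b')
    (f : a ⟶ b) (f' : a' ⟶ b') :
    F.map f = eqToHom (by rw [ha]) ≫ F.map f' ≫ eqToHom (by rw [hb]) := by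
  subst ha hb
  rw [Subsingleton.elim f f']
  simp

/-- Has the shape of the last goal of `ComposableArrows.ext_succ` when both endpoint equalities hold
definitionally. -/
theorem eq_eqToHom_comp_comp {X Y : C} (f : X ⟶ Y) (h : X = X) (h' : Y = Y) :
    f = eqToHom h ≫ f ≫ eqToHom h' := by
  simp

/-- Between equal objects the only morphism is `eqToHom`, so any natural transformation is the
identity up to casts. Strings can thus be compared on objects alone, given one map between them. -/
theorem IsAcyclicCategory.composableArrows_eq (hC : IsAcyclicCategory C) {n : ℕ}
    {F G : ComposableArrows C n} (α : F ⟶ G) (h : ∀ i, F.obj i = G.obj i) : F = G := by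
  have hα : ∀ i, α.app i = eqToHom (h i) := fun i => hC.eq_eqToHom _ _
  have : ∀ i, IsIso (α.app i) := fun i => by rw [hα]; infer_instance
  exact Functor.ext_of_iso
    (NatIso.ofComponents (fun i => asIso (α.app i)) fun f => α.naturality f) h
    (fun i => hα i)

/-- If a later object repeats an earlier one, antisymmetry already makes two consecutive objects
equal, and the string is then a degeneracy of its face. Conversely, a degeneracy repeats an object.
-/
theorem IsAcyclicCategory.mem_nonDegenerate_iff (hC : IsAcyclicCategory C) {n : ℕ}
    (x : ComposableArrows C n) :
    x ∈ (nerve C).nonDegenerate n ↔ Function.Injective x.obj := by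
  constructor
  · intro hx
    by_contra hinj
    obtain ⟨i, j, hij, hlt⟩ : ∃ i j, x.obj i = x.obj j ∧ i < j := by
      rw [Function.Injective] at hinj
      push Not at hinj
      obtain ⟨i, j, hij, hne⟩ := hinj
      rcases lt_or_gt_of_ne hne with h | h
      · exact ⟨i, j, hij, h⟩
      · exact ⟨j, i, hij.symm, h⟩
    obtain _ | n := n
    · omega
    obtain ⟨m, rfl⟩ : ∃ m : Fin (n + 1), m.castSucc = i :=
      ⟨i.castPred (Fin.ne_last_of_lt hlt), by simp⟩
    have hsucc : m.succ ≤ j := by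
      simpa [Fin.le_def, Fin.lt_def, Nat.succ_le_iff] using hlt
    have hm : x.obj m.castSucc = x.obj m.succ :=
      hC.antisymm (x.map (homOfLE (Fin.castSucc_le_succ m)))
        (x.map (homOfLE hsucc) ≫ eqToHom hij.symm)
    have hobj : ∀ l, x.obj (m.castSucc.succAbove (m.predAbove l)) = x.obj l := by
      intro l
      by_cases hl : l = m.castSucc
      · subst hl
        simp [hm]
      · rw [Fin.succAbove_predAbove hl]
    have hle : ∀ l, l ≤ m.castSucc.succAbove (m.predAbove l) := by
      intro l
      by_cases hl : l = m.castSucc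
      · subst hl
        simp [Fin.castSucc_le_succ]
      · rw [Fin.succAbove_predAbove hl]
    -- The comparison map is induced by the inequality `hle`, so only objects have to be compared.
    have key : x = (nerve C).σ m ((nerve C).δ m.castSucc x) := by
      refine hC.composableArrows_eq (n := n + 1)
        { app := fun l => x.map (homOfLE (hle l))
          naturality := ?_ } fun l => (hobj l).symm
      intro a b f
      refine (x.map_comp _ _).symm.trans (Eq.trans ?_ (x.map_comp _ _))
      exact congrArg x.map (Subsingleton.elim _ _)
    rw [key] at hx
    exact hx (SSet.σ_mem_degenerate _ _ _)
  · intro hinj hx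
    obtain _ | n := n
    · rw [SSet.degenerate_zero] at hx
      exact hx
    · rw [SSet.degenerate_eq_iUnion_range_σ] at hx
      obtain ⟨i, y, rfl⟩ := Set.mem_iUnion.1 hx
      have : i.castSucc = i.succ := hinj (congrArg y.obj
        (show i.predAbove i.castSucc = i.predAbove i.succ by simp))
      simp [Fin.ext_iff] at this

theorem IsAcyclicCategory.δ_mem_nonDegenerate (hC : IsAcyclicCategory C) {n : ℕ}
    {x : ComposableArrows C (n + 1)} (hx : x ∈ (nerve C).nonDegenerate (n + 1))
    (i : Fin (n + 2)) : (nerve C).δ i x ∈ (nerve C).nonDegenerate n := by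
  refine (hC.mem_nonDegenerate_iff (n := n) _).2 ?_
  exact ((hC.mem_nonDegenerate_iff x).1 hx).comp Fin.succAbove_right_injective

/-- The objects of a cell are distinct, so the surviving ones determine the omitted index. This
makes the incidence number of a facet unambiguous. -/
theorem IsAcyclicCategory.δ_injective (hC : IsAcyclicCategory C) {n : ℕ}
    {x : ComposableArrows C (n + 1)} (hx : x ∈ (nerve C).nonDegenerate (n + 1))
    {i j : Fin (n + 2)} (h : (nerve C).δ i x = (nerve C).δ j x) : i = j := by
  refine Fin.succAbove_left_injective (funext fun l => ?_)
  exact (hC.mem_nonDegenerate_iff x).1 hx (Functor.congr_obj h l)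

theorem IsAcyclicCategory.precomp_mem_nonDegenerate_iff (hC : IsAcyclicCategory C) {n : ℕ}
    {x : ComposableArrows C n} (hx : x ∈ (nerve C).nonDegenerate n) {X : C} (p : X ⟶ x.left) :
    x.precomp p ∈ (nerve C).nonDegenerate (n + 1) ↔ X ≠ x.left := by
  rw [hC.mem_nonDegenerate_iff] at hx ⊢
  constructor
  · intro h e
    have := @h 0 1 e
    simp at this
  · intro h a b hab
    -- If `X` reappeared at position `c`, the morphisms `X ⟶ x.left ⟶ x.obj c = X` would force `X =
    -- x.left`.
    have key : ∀ c : Fin (n + 1), X ≠ x.obj c := fun c hc =>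
      h (hC.antisymm p (x.map (homOfLE (Fin.zero_le c)) ≫ eqToHom hc.symm))
    induction a using Fin.cases with
    | zero =>
      induction b using Fin.cases with
      | zero => rfl
      | succ b => exact (key b hab).elim
    | succ a =>
      induction b using Fin.cases with
      | zero => exact (key a hab.symm).elim
      | succ b => exact congrArg _ (hx hab)

theorem not_mem_nonDegenerate_precomp (hC : IsAcyclicCategory C) {n : ℕ}
    {x : ComposableArrows C n} (hx : x ∉ (nerve C).nonDegenerate n) {X : C} (p : X ⟶ x.left) :
    x.precomp p ∉ (nerve C).nonDegenerate (n + 1) := by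
  intro h
  exact hx (hC.δ_mem_nonDegenerate h 0)

/-- Together with `δ_succ_succ_precomp`, this says that face `j + 1` of a prepended string is face
`j` with a morphism prepended; for `j = 0` that morphism absorbs the first one of the string. -/
theorem δ_one_precomp {n : ℕ} (x : ComposableArrows C (n + 1)) {X : C} (p : X ⟶ x.left) :
    (nerve C).δ 1 (x.precomp p) =
      ((nerve C).δ 0 x : ComposableArrows C n).precomp (p ≫ x.map' 0 1) := by
  refine ComposableArrows.ext_succ rfl ?_ ?_
  · exact ConcreteCategory.congr_hom ((nerve C).δ_comp_δ (n := n) (i := 0) (j := 0) le_rfl)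
      (x.precomp p)
  · exact eq_eqToHom_comp_comp (X := X) (Y := x.obj 1) (p ≫ x.map' 0 1) rfl rfl

theorem δ_succ_succ_precomp {n : ℕ} (x : ComposableArrows C (n + 1)) {X : C} (p : X ⟶ x.left)
    (j : Fin (n + 1)) :
    (nerve C).δ j.succ.succ (x.precomp p) =
      ((nerve C).δ j.succ x : ComposableArrows C n).precomp (p ≫ eqToHom (by
        exact congrArg x.obj (Fin.succ_succAbove_zero j).symm)) := by
  refine ComposableArrows.ext_succ rfl ?_ ?_
  · exact (ConcreteCategory.congr_hom ((nerve C).δ_comp_δ (n := n) (i := 0) (j := j.succ)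
      (Fin.zero_le _)) (x.precomp p))
  · refine Eq.trans (b := (x.precomp p).map (homOfLE (?_ : (0 : Fin (n + 3)) ≤
        j.succ.succ.succAbove (Fin.succ 0)))) rfl ?_
    · exact Fin.zero_le _
    refine (functor_map_congr (x.precomp p) (a' := 0) (b' := 1) rfl ?_ _
      (homOfLE (Fin.zero_le _))).trans ?_
    · rw [Fin.succ_succAbove_succ, Fin.succ_succAbove_zero]
      rfl
    · refine (Category.id_comp _).trans (Eq.trans ?_ (Category.id_comp _).symm)
      refine Eq.trans ?_ (Category.assoc p _ _).symm
      exact congrArg (p ≫ ·) (eqToHom_trans _ _).symm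

/-- A string of length `0` has no first morphism to compose with: omitting its vertex leaves only
the new source. -/
theorem δ_one_precomp_zero (x : ComposableArrows C 0) {X : C} (p : X ⟶ x.left) :
    (nerve C).δ 1 (x.precomp p) = ComposableArrows.mk₀ X :=
  ComposableArrows.ext₀ rfl

theorem δ_zero_precomp {n : ℕ} (x : ComposableArrows C n) {X : C} (p : X ⟶ x.left) :
    (nerve C).δ 0 (x.precomp p) = x := rfl

theorem precomp_δ_zero {n : ℕ} (x : ComposableArrows C (n + 1)) :
    ((nerve C).δ 0 x : ComposableArrows C n).precomp (x.map' 0 1) = x :=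
  ComposableArrows.ext_succ rfl rfl (eq_eqToHom_comp_comp (x.map' 0 1) rfl rfl)

instance composableArrows_finite [Finite C] [∀ X Y : C, Finite (X ⟶ Y)] (n : ℕ) :
    Finite (ComposableArrows C n) := by
  induction n with
  | zero =>
    exact Finite.of_surjective (fun X : C => ComposableArrows.mk₀ X) fun F =>
      let ⟨X, hX⟩ := ComposableArrows.mk₀_surjective F; ⟨X, hX.symm⟩
  | succ n ih =>
    exact Finite.of_surjective
      (fun z : Σ (F : ComposableArrows C n) (X : C), X ⟶ F.left => z.1.precomp z.2.2) fun F =>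
      let ⟨F₀, X, f, h⟩ := ComposableArrows.precomp_surjective F; ⟨⟨F₀, X, f⟩, h.symm⟩

end Nerve

/-! ### The algebra of a category presented by paths -/

section Algebra

variable {k : Type w} [CommRing k] {Q : Type u} [Quiver.{v} Q] [Fintype Q] {S : PathRelations Q}

theorem pathRel_of_mem_block {a b : Q} {B : Set (Quiver.Path a b)} (hB : B ∈ S.blocks a b)
    {p p' : Quiver.Path a b} (hp : p ∈ B) (hp' : p' ∈ B) :
    pathRel k S (X := a) (Y := b) p p' :=
  TwoSidedIdeal.subset_span ⟨a, b, B, p, p', hB, hp, hp', rfl⟩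

/-- The morphism of `C_A` given by a path. -/
def pathHom {a b : Q} (p : Quiver.Path a b) : (⟨a⟩ : PathCat k S) ⟶ ⟨b⟩ :=
  (CategoryTheory.Quotient.functor (pathRel k S)).map (X := (a : Paths Q)) (Y := b) p

theorem pathHom_surjective {a b : PathCat k S} (f : a ⟶ b) :
    ∃ p : Quiver.Path (V := Q) a.as b.as, pathHom p = f :=
  (CategoryTheory.Quotient.functor (pathRel k S)).map_surjective f

theorem pathHom_comp {a b c : Q} (p : Quiver.Path a b) (q : Quiver.Path b c) :
    pathHom (k := k) (S := S) (p.comp q) = pathHom p ≫ pathHom q := rfl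

theorem pathHom_eq {a b : Q} {p p' : Quiver.Path a b} (h : pathRel k S (X := a) (Y := b) p p') :
    pathHom (k := k) (S := S) p = pathHom p' :=
  CategoryTheory.Quotient.sound _ h

variable {X : Type x} [AddCommGroup X] [Module k X]

/-- The linear map on the path algebra with prescribed values on the morphisms of `C_A`. -/
def pathLift (h : ∀ a b : PathCat k S, (a ⟶ b) → X) : PathAlgebra k Q →ₗ[k] X :=
  Finsupp.linearCombination k (fun q : AllPaths Q =>
    h ⟨q.1⟩ ⟨q.2.1⟩ (pathHom q.2.2))

theorem pathLift_ofPath (h : ∀ a b : PathCat k S, (a ⟶ b) → X) {a b : Q} (p : Quiver.Path a b) :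
    pathLift h (PathAlgebra.ofPath k ⟨a, b, p⟩) =
      h ⟨a⟩ ⟨b⟩ (pathHom p) := by
  unfold pathLift PathAlgebra.ofPath
  erw [Finsupp.linearCombination_single, one_smul]

/-- On paths, either a product vanishes because endpoints do not match, or the two concatenations
give the same morphism of `C_A`. -/
theorem pathLift_mul_sub_mul (h : ∀ a b : PathCat k S, (a ⟶ b) → X) {a b : Q}
    {p p' : Quiver.Path a b} (hp : pathRel k S (X := a) (Y := b) p p') (y z : PathAlgebra k Q) :
    pathLift h (y * (PathAlgebra.ofPath k ⟨a, b, p⟩ - PathAlgebra.ofPath k ⟨a, b, p'⟩) * z) =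
      0 := by
  induction y using PathAlgebra.induction with
  | zero => simp
  | add y y' hy hy' => rw [add_mul, add_mul, map_add, hy, hy', add_zero]
  | smul c y =>
  induction z using PathAlgebra.induction with
  | zero => simp
  | add y y' hy hy' => rw [mul_add, map_add, hy, hy', add_zero]
  | smul d z =>
  rw [smul_mul_assoc, mul_smul_comm, smul_mul_assoc, map_smul, map_smul]
  suffices pathLift h (PathAlgebra.ofPath k y *
      (PathAlgebra.ofPath k ⟨a, b, p⟩ - PathAlgebra.ofPath k ⟨a, b, p'⟩) *
        PathAlgebra.ofPath k z) = 0 by rw [this, smul_zero, smul_zero]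
  obtain ⟨s, t, y⟩ := y
  obtain ⟨s', t', z⟩ := z
  by_cases h1 : a = t
  · subst h1
    by_cases h2 : s' = b
    · subst h2
      rw [mul_sub, PathAlgebra.ofPath_mul_of_eq, PathAlgebra.ofPath_mul_of_eq, sub_mul,
        PathAlgebra.ofPath_mul_of_eq, PathAlgebra.ofPath_mul_of_eq, map_sub, pathLift_ofPath,
        pathLift_ofPath, sub_eq_zero]
      simp only [pathHom_comp, pathHom_eq hp]
    · rw [mul_assoc, sub_mul, PathAlgebra.ofPath_mul_of_ne h2, PathAlgebra.ofPath_mul_of_ne h2]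
      simp
  · rw [mul_sub, PathAlgebra.ofPath_mul_of_ne h1, PathAlgebra.ofPath_mul_of_ne h1]
    simp

theorem pathLift_eq_zero (h : ∀ a b : PathCat k S, (a ⟶ b) → X) {y : PathAlgebra k Q}
    (hy : y ∈ relIdeal k S) : pathLift h y = 0 := by
  -- The kernel of `pathLift h` need not visibly be an ideal, so vanishing is required after all
  -- two-sided multiplications.
  let J : TwoSidedIdeal (PathAlgebra k Q) := TwoSidedIdeal.mk'
    {y | ∀ a b : PathAlgebra k Q, pathLift h (a * y * b) = 0}
    (fun a b => by simp)
    (fun {y z} hy hz a b => by rw [mul_add, add_mul, map_add, hy, hz, add_zero])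
    (fun {y} hy a b => by rw [mul_neg, neg_mul, map_neg, hy, neg_zero])
    (fun {y z} hz a b => by rw [← mul_assoc]; exact hz _ _)
    (fun {y z} hy a b => by rw [← mul_assoc, mul_assoc]; exact hy _ _)
  have hJ : y ∈ J := by
    refine TwoSidedIdeal.mem_span_iff.1 hy J ?_
    rintro _ ⟨a, b, B, p, p', hB, hp, hp', rfl⟩
    refine (TwoSidedIdeal.mem_mk' _ _ _ _ _ _ _).2 fun y z => ?_
    exact pathLift_mul_sub_mul h (pathRel_of_mem_block hB hp hp') y z
  have := (TwoSidedIdeal.mem_mk' _ _ _ _ _ _ _).1 hJ 1 1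
  rwa [one_mul, mul_one] at this

/-- The linear map on `A` with prescribed values on the morphisms of `C_A`. -/
def homLift (h : ∀ a b : PathCat k S, (a ⟶ b) → X) : QuotAlg k S →ₗ[k] X where
  toFun := Quotient.lift (pathLift h) (fun a b hab => by
    rw [← sub_eq_zero, ← map_sub]
    exact pathLift_eq_zero h ((TwoSidedIdeal.rel_iff _ _ _).1 hab))
  map_add' a b := by
    induction a using Quotient.inductionOn
    induction b using Quotient.inductionOn
    exact map_add (pathLift h) _ _
  map_smul' c a := by
    induction a using Quotient.inductionOn
    exact map_smul (pathLift h) _ _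

theorem homLift_homClass (h : ∀ a b : PathCat k S, (a ⟶ b) → X) {a b : PathCat k S} (f : a ⟶ b) :
    homLift h (homClass k S f) = h a b f := by
  obtain ⟨f, rfl⟩ := pathHom_surjective f
  exact pathLift_ofPath h f

theorem pathClass_mul_of_eq {a b c : Q} (p : Quiver.Path a b) (q : Quiver.Path b c) :
    pathClass k S ⟨a, b, p⟩ * pathClass k S ⟨b, c, q⟩ = pathClass k S ⟨a, c, p.comp q⟩ := by
  exact congrArg (relIdeal k S).ringCon.mk' (PathAlgebra.ofPath_mul_of_eq p q)

theorem homClass_comp {a b c : PathCat k S} (f : a ⟶ b) (g : b ⟶ c) :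
    homClass k S (f ≫ g) = homClass k S f * homClass k S g := by
  obtain ⟨f, rfl⟩ := pathHom_surjective f
  obtain ⟨g, rfl⟩ := pathHom_surjective g
  exact (pathClass_mul_of_eq f g).symm

theorem homClass_id (a : PathCat k S) : homClass k S (𝟙 a) = idem k S a.as := rfl

theorem homClass_mul_of_ne {a b c d : PathCat k S} (f : a ⟶ b) (g : c ⟶ d) (h : c ≠ b) :
    homClass k S f * homClass k S g = 0 := by
  obtain ⟨f, rfl⟩ := pathHom_surjective f
  obtain ⟨g, rfl⟩ := pathHom_surjective g
  have : c.as ≠ b.as := fun e => h (by cases b; cases c; exact congrArg _ e)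
  exact congrArg (relIdeal k S).ringCon.mk'
    (PathAlgebra.ofPath_mul_of_ne (k := k) (p := (⟨a.as, b.as, f⟩ : AllPaths Q))
      (q := (⟨c.as, d.as, g⟩ : AllPaths Q)) this)

theorem idem_mul_homClass {a b : PathCat k S} (f : a ⟶ b) :
    idem k S a.as * homClass k S f = homClass k S f := by
  rw [← homClass_id, ← homClass_comp, Category.id_comp]

theorem homClass_mul_idem {a b : PathCat k S} (f : a ⟶ b) :
    homClass k S f * idem k S b.as = homClass k S f := by
  rw [← homClass_id, ← homClass_comp, Category.comp_id]

theorem idem_mul_idem (a : Q) : idem k S a * idem k S a = idem k S a := by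
  have h := idem_mul_homClass (𝟙 (⟨a⟩ : PathCat k S))
  rwa [homClass_id] at h

theorem homClass_comp_eqToHom {a b c : PathCat k S} (f : a ⟶ b) (h : b = c) :
    homClass k S (f ≫ eqToHom h) = homClass k S f := by
  subst h
  simp

variable (k S) in
/-- The quotient map from the path algebra to `A`. -/
def quotHom : PathAlgebra k Q →+* QuotAlg k S := (relIdeal k S).ringCon.mk'

theorem sum_idem : ∑ a : Q, idem k S a = 1 :=
  calc ∑ a : Q, idem k S a
      = ∑ a : Q, quotHom k S (PathAlgebra.ofPath k ⟨a, a, Quiver.Path.nil⟩) := rfl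
    _ = quotHom k S 1 := by rw [PathAlgebra.one_def, map_sum]
    _ = 1 := map_one _

theorem QuotAlg.induction {P : QuotAlg k S → Prop} (z : QuotAlg k S) (zero : P 0)
    (add : ∀ x y, P x → P y → P (x + y))
    (smul : ∀ (c : k) {a b : PathCat k S} (f : a ⟶ b), P (c • homClass k S f)) : P z := by
  obtain ⟨z, rfl⟩ := (relIdeal k S).ringCon.mk'_surjective z
  induction z using PathAlgebra.induction with
  | zero => rwa [map_zero]
  | add y y' hy hy' => rw [map_add]; exact add _ _ hy hy'
  | smul c p => exact smul c (pathHom p.2.2)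

end Algebra

/-! ### The category of an acyclic quiver -/

section Acyclic

variable {k : Type w} [CommRing k] {Q : Type u} [Quiver.{v} Q] [Fintype Q] {S : PathRelations Q}

theorem IsAcyclicQuiver.pathCat (hQ : IsAcyclicQuiver Q) : IsAcyclicCategory (PathCat k S) where
  hom_self {X} f := by
    obtain ⟨f, rfl⟩ := pathHom_surjective f
    rw [hQ X.as f]
    rfl
  antisymm {X Y} f g := by
    obtain ⟨f, rfl⟩ := pathHom_surjective f
    obtain ⟨g, rfl⟩ := pathHom_surjective g
    have h : f.length + g.length = 0 := (Quiver.Path.length_comp f g).symm.trans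
      (congrArg Quiver.Path.length (hQ X.as (f.comp g)))
    have := Quiver.Path.eq_of_length_zero f (by omega)
    cases X; cases Y; exact congrArg _ this

/-- "Joined by a nonconstant path" is a transitive irreflexive relation on a finite set, hence
well-founded. By induction on the endpoint, a path is constant or ends with one of finitely many
arrows. -/
theorem IsAcyclicQuiver.finite_path [∀ a b : Q, Finite (a ⟶ b)] (hQ : IsAcyclicQuiver Q)
    (a b : Q) : Finite (Quiver.Path a b) := by
  let R : Q → Q → Prop := fun x y => ∃ p : Quiver.Path x y, p.length ≠ 0
  have : IsTrans Q R := ⟨fun x y z ⟨p, hp⟩ ⟨q, hq⟩ => ⟨p.comp q, by simp; omega⟩⟩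
  have : Std.Irrefl R := ⟨fun x ⟨p, hp⟩ => hp (by rw [hQ x p]; rfl)⟩
  have hwf : WellFounded R := Finite.wellFounded_of_trans_of_irrefl R
  induction b using hwf.induction with | _ b ih
  have h1 : ∀ z : (Σ c, c ⟶ b), Finite (Quiver.Path a z.1) := fun z =>
    ih z.1 ⟨z.2.toPath, by simp⟩
  refine Finite.of_surjective (α := PLift (a = b) ⊕ Σ z : (Σ c, c ⟶ b), Quiver.Path a z.1)
    (Sum.elim (fun h => h.down ▸ Quiver.Path.nil) (fun z => z.2.cons z.1.2)) fun p => ?_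
  cases p with
  | nil => exact ⟨.inl ⟨rfl⟩, rfl⟩
  | cons p e => exact ⟨.inr ⟨⟨_, e⟩, p⟩, rfl⟩

theorem IsAcyclicQuiver.finite_cell [∀ a b : Q, Finite (a ⟶ b)] (hQ : IsAcyclicQuiver Q)
    (n : ℕ) : Finite (Cell k S n) := by
  have : ∀ X Y : PathCat k S, Finite (X ⟶ Y) := fun X Y =>
    have : Finite (Quiver.Path (V := Q) X.as Y.as) := hQ.finite_path _ _
    Finite.of_surjective (fun p : Quiver.Path (V := Q) X.as Y.as => pathHom p) pathHom_surjective
  have : Finite (PathCat k S) := Finite.of_injective (β := Q) (fun X => X.as) fun X Y h => by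
    cases X; cases Y; exact congrArg _ h
  exact Finite.of_injective (fun σ : Cell k S n => σ.arrows) fun σ τ h => Cell.ext h

end Acyclic

/-! ### Generators of the cellular modules -/

section Generators

open scoped Classical

variable {k : Type w} [CommRing k] {Q : Type u} [Quiver.{v} Q] [Fintype Q] {S : PathRelations Q}

theorem Env.tmul_mul_tmul (l r l' r' : QuotAlg k S) :
    Env.tmul l r * Env.tmul l' r' = Env.tmul (l * l') (r' * r) := by
  exact Algebra.TensorProduct.tmul_mul_tmul l l' (MulOpposite.op r) (MulOpposite.op r')

theorem Env.tmul_smul (l r z : QuotAlg k S) : Env.tmul l r • z = l * z * r := by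
  exact AlgHom.mulLeftRight_apply k (QuotAlg k S) l (MulOpposite.op r) z

theorem envIdem_mul_self (a b : Q) : envIdem k S a b * envIdem k S a b = envIdem k S a b := by
  rw [envIdem, Env.tmul_mul_tmul, idem_mul_idem, idem_mul_idem]

theorem mul_envIdem_mem (a b : Q) (y : Env k S) : y * envIdem k S a b ∈ boxProj k S a b :=
  Submodule.smul_mem _ y (Submodule.subset_span rfl)

theorem mul_envIdem_of_mem {a b : Q} {y : Env k S} (hy : y ∈ boxProj k S a b) :
    y * envIdem k S a b = y := by
  obtain ⟨z, rfl⟩ := Submodule.mem_span_singleton.1 hy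
  rw [smul_eq_mul, mul_assoc, envIdem_mul_self]

variable {n : ℕ}

/-- The element `e_t ⊗ e_h` of `A ⊗ Aᵒᵖ` for a string from `t` to `h`. -/
def endIdem (s : ComposableArrows (PathCat k S) n) : Env k S :=
  envIdem k S (s.obj 0).as (s.obj (Fin.last n)).as

theorem endIdem_mul_self (s : ComposableArrows (PathCat k S) n) :
    endIdem s * endIdem s = endIdem s :=
  envIdem_mul_self _ _

/-- The map `y ↦ y ⊗ [s]` from `A ⊗ Aᵒᵖ` to the cellular module; it is zero if `s` is
degenerate. -/
def incl (s : ComposableArrows (PathCat k S) n) : Env k S →ₗ[Env k S] CellularModule k S n :=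
  if h : s ∈ (nerve (PathCat k S)).nonDegenerate n then
    (DirectSum.lof (Env k S) _ (fun τ : Cell k S n => τ.proj) ⟨s, h⟩).comp
      (LinearMap.toSpanSingleton (Env k S) (Cell.proj (⟨s, h⟩ : Cell k S n))
        ⟨endIdem s, Submodule.subset_span rfl⟩)
  else 0

theorem incl_of_not_mem {s : ComposableArrows (PathCat k S) n}
    (h : s ∉ (nerve (PathCat k S)).nonDegenerate n) : incl s = 0 :=
  dif_neg h

theorem incl_cell (σ : Cell k S n) (y : Env k S) :
    incl σ.arrows y = DirectSum.lof (Env k S) _ (fun τ : Cell k S n => τ.proj) σ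
      ⟨y * endIdem σ.arrows, mul_envIdem_mem _ _ y⟩ := by
  rw [incl, dif_pos σ.nonDegenerate]
  rfl

theorem lof_eq_incl (σ : Cell k S n) (y : σ.proj) :
    DirectSum.lof (Env k S) _ (fun τ : Cell k S n => τ.proj) σ y = incl σ.arrows y := by
  rw [incl_cell]
  congr 1
  exact Subtype.ext (mul_envIdem_of_mem y.2).symm

/-- `incl s` itself multiplies by the idempotent. Generators can therefore be handled with
coefficients in the whole enveloping algebra instead of a submodule. -/
theorem incl_mul_endIdem (s : ComposableArrows (PathCat k S) n) (y : Env k S) :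
    incl s (y * endIdem s) = incl s y := by
  by_cases h : s ∈ (nerve (PathCat k S)).nonDegenerate n
  · have h1 := incl_cell ⟨s, h⟩ (y * endIdem s)
    have h2 := incl_cell ⟨s, h⟩ y
    refine h1.trans (Eq.trans ?_ h2.symm)
    congr 1
    exact Subtype.ext (by simp only [mul_assoc, endIdem_mul_self])
  · rw [incl_of_not_mem h]
    rfl

theorem incl_eq_smul (s : ComposableArrows (PathCat k S) n) (y : Env k S) :
    incl s y = y • incl s 1 := by
  rw [← map_smul, smul_eq_mul, mul_one]

theorem endIdem_smul_incl_one (s : ComposableArrows (PathCat k S) n) :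
    endIdem s • incl s 1 = incl s 1 := by
  rw [← incl_eq_smul, ← one_mul (endIdem s), incl_mul_endIdem]

variable {X : Type x}

/-- Stated for additive maps because the contracting homotopy is not linear over the left factor. -/
theorem cellular_addHom_ext [AddCommMonoid X] {f g : CellularModule k S n →+ X}
    (h : ∀ (σ : Cell k S n) (y : Env k S), f (incl σ.arrows y) = g (incl σ.arrows y)) : f = g := by
  refine DirectSum.addHom_ext fun σ y => ?_
  have := h σ y
  rwa [← lof_eq_incl] at this

variable [AddCommGroup X] [Module (Env k S) X]

theorem cellular_hom_ext {f g : CellularModule k S n →ₗ[Env k S] X}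
    (h : ∀ σ : Cell k S n, f (incl σ.arrows 1) = g (incl σ.arrows 1)) : f = g := by
  refine LinearMap.toAddMonoidHom_injective (cellular_addHom_ext fun σ y => ?_)
  simp only [LinearMap.toAddMonoidHom_coe]
  rw [incl_eq_smul, map_smul, map_smul, h]

/-- The linear map on the cellular module with prescribed values on generators. -/
def cellDesc (c : Cell k S n → X) : CellularModule k S n →ₗ[Env k S] X :=
  DirectSum.toModule _ _ _ fun σ =>
    (LinearMap.toSpanSingleton (Env k S) X (c σ)).comp (σ.proj).subtype

/-- The idempotent remains because `c σ` is arbitrary; the generator goes to `c σ` only when the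
idempotent fixes `c σ`. -/
theorem cellDesc_incl (c : Cell k S n → X) (σ : Cell k S n) (y : Env k S) :
    cellDesc c (incl σ.arrows y) = (y * endIdem σ.arrows) • c σ := by
  rw [incl_cell, cellDesc, DirectSum.toModule_lof]
  rfl

theorem cellDesc_incl_one (c : Cell k S n → X) (σ : Cell k S n) :
    cellDesc c (incl σ.arrows 1) = endIdem σ.arrows • c σ := by
  rw [cellDesc_incl, one_mul]

end Generators

/-! ### The cellular differential on generators -/

section Differential

open scoped Classical

variable {k : Type w} [CommRing k] {Q : Type u} [Quiver.{v} Q] [Fintype Q] {S : PathRelations Q}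
variable {n : ℕ}

/-- The left coefficient of the `i`-th face of a string. -/
def faceLeft (i : Fin (n + 2)) (s : ComposableArrows (PathCat k S) (n + 1)) : QuotAlg k S :=
  if i = 0 then homClass k S (s.map' 0 1) else 1

/-- The right coefficient of the `i`-th face of a string. -/
def faceRight (i : Fin (n + 2)) (s : ComposableArrows (PathCat k S) (n + 1)) : QuotAlg k S :=
  if i = Fin.last (n + 1) then homClass k S (s.map' n (n + 1)) else 1

/-- The coefficient of the `i`-th face of a string, as an element of `A ⊗ Aᵒᵖ`. -/
def faceCoeff (i : Fin (n + 2)) (s : ComposableArrows (PathCat k S) (n + 1)) : Env k S :=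
  Env.tmul (faceLeft i s) (faceRight i s)

/-- The `i`-th face of a string. -/
def faceOf (i : Fin (n + 2)) (s : ComposableArrows (PathCat k S) (n + 1)) :
    ComposableArrows (PathCat k S) n :=
  (nerve (PathCat k S)).δ i s

/-- Omitting an outer vertex cuts off a morphism joining the old endpoint to the new one, and this
morphism absorbs both idempotents. Any other omission keeps the endpoint and has coefficient `1`. -/
theorem endIdem_mul_faceCoeff (i : Fin (n + 2)) (s : ComposableArrows (PathCat k S) (n + 1)) :
    endIdem s * faceCoeff i s = faceCoeff i s * endIdem (faceOf i s) := by
  have hl : idem k S (s.obj 0).as * faceLeft i s =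
      faceLeft i s * idem k S ((faceOf i s).obj 0).as := by
    unfold faceLeft
    split_ifs with h
    · subst h
      exact (idem_mul_homClass (s.map' 0 1)).trans (homClass_mul_idem (s.map' 0 1)).symm
    · obtain ⟨j, rfl⟩ := Fin.exists_succ_eq.2 h
      have : (faceOf j.succ s).obj 0 = s.obj 0 := congrArg s.obj (Fin.succ_succAbove_zero j)
      rw [this, one_mul, mul_one]
  have hr : faceRight i s * idem k S (s.obj (Fin.last (n + 1))).as =
      idem k S ((faceOf i s).obj (Fin.last n)).as * faceRight i s := by
    unfold faceRight
    split_ifs with h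
    · subst h
      have : (faceOf (Fin.last (n + 1)) s).obj (Fin.last n) = s.obj ⟨n, by omega⟩ :=
        congrArg s.obj (Fin.succAbove_last_apply _)
      rw [this]
      exact (homClass_mul_idem (s.map' n (n + 1))).trans (idem_mul_homClass (s.map' n (n + 1))).symm
    · have : (faceOf i s).obj (Fin.last n) = s.obj (Fin.last (n + 1)) :=
        congrArg s.obj (Fin.succAbove_ne_last_last h)
      rw [this, one_mul, mul_one]
  unfold faceCoeff endIdem envIdem
  rw [Env.tmul_mul_tmul, Env.tmul_mul_tmul, hl, hr]

/-- Faces of cells are cells here, so the zero branch of `cellularD` does not occur, and the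
idempotents can be moved past the face coefficients. -/
theorem cellularD_incl (hC : IsAcyclicCategory (PathCat k S)) (σ : Cell k S (n + 1))
    (y : Env k S) :
    cellularD k S n (incl σ.arrows y) = ∑ i : Fin (n + 2), ((-1 : ℤ) ^ (i : ℕ)) •
      incl (faceOf i σ.arrows) (y * faceCoeff i σ.arrows) := by
  rw [incl_cell, cellularD, DirectSum.toModule_lof, LinearMap.sum_apply]
  refine Finset.sum_congr rfl fun i _ => ?_
  have h : σ.face i ∈ (nerve (PathCat k S)).nonDegenerate n :=
    hC.δ_mem_nonDegenerate σ.nonDegenerate i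
  rw [dif_pos h, LinearMap.smul_apply]
  congr 1
  refine Eq.trans ?_ (incl_cell ⟨σ.face i, h⟩ _).symm
  rw [LinearMap.comp_apply]
  congr 1
  refine Subtype.ext ?_
  change (y * endIdem σ.arrows) * (faceCoeff i σ.arrows * endIdem (faceOf i σ.arrows)) =
    y * faceCoeff i σ.arrows * endIdem (faceOf i σ.arrows)
  rw [← mul_assoc, mul_assoc y, endIdem_mul_faceCoeff, ← mul_assoc, mul_assoc, endIdem_mul_self]

end Differential

/-! ### The contracting homotopy of the augmented cellular complex -/

section Contraction

open scoped Classical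

variable {k : Type w} [CommRing k] {Q : Type u} [Quiver.{v} Q] [Fintype Q] {S : PathRelations Q}
variable {n : ℕ}

theorem Env.tmul_add (l r r' : QuotAlg k S) :
    Env.tmul l (r + r') = Env.tmul l r + Env.tmul l r' :=
  TensorProduct.tmul_add l (MulOpposite.op r) (MulOpposite.op r')

theorem Env.add_tmul (l l' r : QuotAlg k S) :
    Env.tmul (l + l') r = Env.tmul l r + Env.tmul l' r :=
  TensorProduct.add_tmul l l' (MulOpposite.op r)

theorem Env.zero_tmul (r : QuotAlg k S) : Env.tmul 0 r = 0 :=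
  TensorProduct.zero_tmul _ (MulOpposite.op r)

theorem Env.tmul_zero (l : QuotAlg k S) : Env.tmul l 0 = 0 :=
  TensorProduct.tmul_zero _ l

theorem Env.smul_tmul (c : k) (l r : QuotAlg k S) : Env.tmul (c • l) r = Env.tmul l (c • r) :=
  TensorProduct.smul_tmul c l (MulOpposite.op r)

/-- Scalars are pushed into the right factor, so tensors with a single morphism on the left suffice.
-/
theorem Env.induction {P : Env k S → Prop} (y : Env k S) (zero : P 0)
    (add : ∀ x y, P x → P y → P (x + y))
    (tmul : ∀ {a b : PathCat k S} (p : a ⟶ b) (r : QuotAlg k S), P (Env.tmul (homClass k S p) r)) :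
    P y := by
  refine TensorProduct.induction_on (motive := P) y zero (fun l r => ?_) add
  obtain ⟨r, rfl⟩ := MulOpposite.op_surjective r
  change P (Env.tmul l r)
  induction l using QuotAlg.induction with
  | zero => rwa [Env.zero_tmul]
  | add l l' h h' => rw [Env.add_tmul]; exact add _ _ h h'
  | smul c f => rw [Env.smul_tmul]; exact tmul f _

theorem Env.addHom_ext {X : Type x} [AddCommMonoid X] {f g : Env k S →+ X}
    (h : ∀ {a b : PathCat k S} (p : a ⟶ b) (r : QuotAlg k S),
      f (Env.tmul (homClass k S p) r) = g (Env.tmul (homClass k S p) r)) : f = g := by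
  refine DFunLike.ext _ _ fun y => ?_
  induction y using Env.induction with
  | zero => rw [map_zero, map_zero]
  | add y y' h h' => rw [map_add, map_add, h, h']
  | tmul p r => exact h p r

theorem endIdem_def (s : ComposableArrows (PathCat k S) n) :
    endIdem s = Env.tmul (idem k S (s.obj 0).as) (idem k S (s.obj (Fin.last n)).as) := rfl

theorem incl_tmul_of_ne (s : ComposableArrows (PathCat k S) n) {a b : PathCat k S} (p : a ⟶ b)
    (h : b ≠ s.left) (r : QuotAlg k S) : incl s (Env.tmul (homClass k S p) r) = 0 := by
  rw [← incl_mul_endIdem, endIdem_def, Env.tmul_mul_tmul]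
  have : homClass k S p * idem k S (s.obj 0).as = 0 :=
    homClass_mul_of_ne p (𝟙 (s.obj 0)) (Ne.symm h)
  rw [this, Env.zero_tmul, map_zero]

theorem incl_idem_tmul (s : ComposableArrows (PathCat k S) n) (r : QuotAlg k S) :
    incl s (Env.tmul (idem k S s.left.as) r) = incl s (Env.tmul 1 r) := by
  rw [← incl_mul_endIdem, ← incl_mul_endIdem s (Env.tmul 1 r), endIdem_def, Env.tmul_mul_tmul,
    Env.tmul_mul_tmul, one_mul]
  congr 2
  exact idem_mul_idem _

theorem cellular_addHom_ext_tmul {X : Type x} [AddCommMonoid X] {f g : CellularModule k S n →+ X}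
    (h : ∀ (σ : Cell k S n) {a : PathCat k S} (p : a ⟶ σ.arrows.left) (r : QuotAlg k S),
      f (incl σ.arrows (Env.tmul (homClass k S p) r)) =
        g (incl σ.arrows (Env.tmul (homClass k S p) r))) : f = g := by
  refine cellular_addHom_ext fun σ y => ?_
  suffices h : f.comp (incl σ.arrows).toAddMonoidHom = g.comp (incl σ.arrows).toAddMonoidHom from
    DFunLike.congr_fun h y
  refine Env.addHom_ext fun {a b} p r => ?_
  change f (incl σ.arrows _) = g (incl σ.arrows _)
  by_cases hb : b = σ.arrows.left
  · subst hb
    exact h σ p r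
  · rw [incl_tmul_of_ne _ p hb, map_zero, map_zero]

/-- The value on a morphism of the contraction at a string: the morphism is put in front of the
string. -/
def prependVal (s : ComposableArrows (PathCat k S) n) (a b : PathCat k S) (p : a ⟶ b) :
    (QuotAlg k S)ᵐᵒᵖ →ₗ[k] CellularModule k S (n + 1) :=
  if h : b = s.left then
    ((incl (s.precomp (p ≫ eqToHom h))).restrictScalars k).comp
      (TensorProduct.mk k (QuotAlg k S) (QuotAlg k S)ᵐᵒᵖ 1)
  else 0

/-- The map `p ⊗ r ↦ 1 ⊗ [p s] ⊗ r`, for `p` a morphism ending where `s` starts. -/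
def prepend (s : ComposableArrows (PathCat k S) n) : Env k S →+ CellularModule k S (n + 1) :=
  (TensorProduct.lift (homLift (prependVal s))).toAddMonoidHom

theorem prepend_tmul (s : ComposableArrows (PathCat k S) n) {a : PathCat k S} (p : a ⟶ s.left)
    (r : QuotAlg k S) :
    prepend s (Env.tmul (homClass k S p) r) = incl (s.precomp p) (Env.tmul 1 r) := by
  refine (TensorProduct.lift.tmul _ (MulOpposite.op r)).trans ?_
  rw [homLift_homClass, prependVal, dif_pos rfl, eqToHom_refl, Category.comp_id]
  rfl

theorem prepend_tmul_of_ne (s : ComposableArrows (PathCat k S) n) {a b : PathCat k S} (p : a ⟶ b)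
    (h : b ≠ s.left) (r : QuotAlg k S) : prepend s (Env.tmul (homClass k S p) r) = 0 := by
  refine (TensorProduct.lift.tmul _ (MulOpposite.op r)).trans ?_
  rw [homLift_homClass, prependVal, dif_neg h]
  rfl

/-- Prepending leaves the last object alone, so the right idempotent of `s` is still absorbed. -/
theorem incl_precomp_idem_mul (s : ComposableArrows (PathCat k S) n) {a : PathCat k S}
    (p : a ⟶ s.left) (l r : QuotAlg k S) :
    incl (s.precomp p) (Env.tmul l (idem k S (s.obj (Fin.last n)).as * r)) =
      incl (s.precomp p) (Env.tmul l r) := by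
  rw [← incl_mul_endIdem, ← incl_mul_endIdem _ (Env.tmul l r)]
  unfold endIdem envIdem
  rw [Env.tmul_mul_tmul, Env.tmul_mul_tmul, ← mul_assoc]
  congr 3
  exact idem_mul_idem _

/-- Ensures that the contraction, defined on the submodules of the direct sum, agrees with `prepend`
for all coefficients. -/
theorem prepend_mul_endIdem (s : ComposableArrows (PathCat k S) n) (y : Env k S) :
    prepend s (y * endIdem s) = prepend s y := by
  induction y using Env.induction with
  | zero => rw [zero_mul]
  | add y y' h h' => rw [add_mul, map_add, map_add, h, h']
  | @tmul a b p r =>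
    unfold endIdem envIdem
    rw [Env.tmul_mul_tmul]
    by_cases hb : b = s.left
    · subst hb
      rw [prepend_tmul, ← incl_precomp_idem_mul, ← prepend_tmul]
      congr 2
      exact homClass_mul_idem p
    · rw [prepend_tmul_of_ne s p hb]
      have : homClass k S p * idem k S (s.obj 0).as = 0 :=
        homClass_mul_of_ne p (𝟙 (s.obj 0)) (Ne.symm hb)
      rw [this, Env.zero_tmul, map_zero]

theorem prepend_of_not_mem (hC : IsAcyclicCategory (PathCat k S))
    {s : ComposableArrows (PathCat k S) n}
    (hs : s ∉ (nerve (PathCat k S)).nonDegenerate n) : prepend s = 0 := by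
  refine Env.addHom_ext fun {a b} p r => ?_
  by_cases hb : b = s.left
  · subst hb
    rw [prepend_tmul, incl_of_not_mem (not_mem_nonDegenerate_precomp hC hs p)]
    rfl
  · rw [prepend_tmul_of_ne s p hb]
    rfl

variable (k S n) in
/-- The contracting homotopy of the cellular complex. -/
def contraction : CellularModule k S n →+ CellularModule k S (n + 1) :=
  DirectSum.toAddMonoid fun σ : Cell k S n =>
    (prepend σ.arrows).comp (σ.proj).subtype.toAddMonoidHom

/-- Degenerate strings are allowed: both sides vanish on them, because prepending cannot remove a
repetition. -/
theorem contraction_incl (hC : IsAcyclicCategory (PathCat k S))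
    (s : ComposableArrows (PathCat k S) n) (y : Env k S) :
    contraction k S n (incl s y) = prepend s y := by
  by_cases hs : s ∈ (nerve (PathCat k S)).nonDegenerate n
  · have h := incl_cell ⟨s, hs⟩ y
    rw [h]
    refine (DirectSum.toAddMonoid_of _ (⟨s, hs⟩ : Cell k S n) _).trans ?_
    exact prepend_mul_endIdem s y
  · rw [incl_of_not_mem hs, prepend_of_not_mem hC hs]
    exact map_zero _

variable (k S n) in
/-- The augmentation of the cellular complex, given by multiplication. -/
def cellularAug : CellularModule k S 0 →ₗ[Env k S] QuotAlg k S :=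
  cellDesc fun _ => 1

variable (k S) in
/-- The contracting homotopy in degree `-1`. -/
def contractionAug : QuotAlg k S →+ CellularModule k S 0 :=
  AddMonoidHom.mk' (fun z => ∑ a : Q,
      incl (ComposableArrows.mk₀ (⟨a⟩ : PathCat k S)) (Env.tmul 1 z))
    fun y z => by simp only [Env.tmul_add, map_add, Finset.sum_add_distrib]

theorem mem_nonDegenerate_zero (s : ComposableArrows (PathCat k S) 0) :
    s ∈ (nerve (PathCat k S)).nonDegenerate 0 := by
  rw [SSet.nondegenerate_zero]
  trivial

theorem cellularAug_incl (s : ComposableArrows (PathCat k S) 0) (y : Env k S) :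
    cellularAug k S (incl s y) = y • idem k S (s.obj 0).as := by
  refine (cellDesc_incl _ ⟨s, mem_nonDegenerate_zero s⟩ y).trans ?_
  rw [mul_smul]
  congr 1
  refine (Env.tmul_smul _ _ _).trans ?_
  rw [mul_one]
  exact idem_mul_idem _

theorem cellularAug_contractionAug (z : QuotAlg k S) :
    cellularAug k S (contractionAug k S z) = z := by
  refine (map_sum (cellularAug k S) _ _).trans ?_
  simp only [cellularAug_incl, Env.tmul_smul, one_mul]
  rw [← Finset.sum_mul]
  exact (congrArg (· * z) sum_idem).trans (one_mul z)

theorem cellularD_incl_of_mem (hC : IsAcyclicCategory (PathCat k S))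
    {s : ComposableArrows (PathCat k S) (n + 1)}
    (hs : s ∈ (nerve (PathCat k S)).nonDegenerate (n + 1)) (y : Env k S) :
    cellularD k S n (incl s y) = ∑ i : Fin (n + 2), ((-1 : ℤ) ^ (i : ℕ)) •
      incl (faceOf i s) (y * faceCoeff i s) :=
  cellularD_incl hC ⟨s, hs⟩ y

theorem faceCoeff_zero_precomp (s : ComposableArrows (PathCat k S) n) {a : PathCat k S}
    (p : a ⟶ s.left) : faceCoeff 0 (s.precomp p) = Env.tmul (homClass k S p) 1 := by
  unfold faceCoeff faceLeft faceRight
  rw [if_pos rfl, if_neg (by simp [Fin.ext_iff])]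
  rfl

theorem faceCoeff_succ_precomp (s : ComposableArrows (PathCat k S) (n + 1)) {a : PathCat k S}
    (p : a ⟶ s.left) (j : Fin (n + 2)) :
    faceCoeff j.succ (s.precomp p) = Env.tmul 1 (faceRight j s) := by
  unfold faceCoeff faceLeft faceRight
  rw [if_neg (Fin.succ_ne_zero j)]
  by_cases h : j = Fin.last (n + 1)
  · subst h
    rw [if_pos rfl, if_pos (Fin.succ_last _)]
    rfl
  · rw [if_neg h, if_neg (fun e => h (Fin.succ_injective _ (e.trans (Fin.succ_last _).symm)))]

/-- In degree `0` the prepended morphism is also the last one, so it is cut off on the right, unlike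
in `faceCoeff_succ_precomp`. -/
theorem faceCoeff_one_precomp (s : ComposableArrows (PathCat k S) 0) {a : PathCat k S}
    (p : a ⟶ s.left) : faceCoeff 1 (s.precomp p) = Env.tmul 1 (homClass k S p) := by
  unfold faceCoeff faceLeft faceRight
  rw [if_neg (by simp), if_pos (by rfl)]
  rfl

/-- Contracting after face `j` is face `j + 1` after contracting. For `j = 0` the left coefficient
is composed with `p`, exactly as the inner face composes the two morphisms. -/
theorem prepend_face (s : ComposableArrows (PathCat k S) (n + 1)) {a : PathCat k S}
    (p : a ⟶ s.left) (r : QuotAlg k S) (j : Fin (n + 2)) :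
    prepend (faceOf j s) (Env.tmul (homClass k S p) r * faceCoeff j s) =
      incl (faceOf j.succ (s.precomp p)) (Env.tmul 1 (faceRight j s * r)) := by
  induction j using Fin.cases with
  | zero =>
    have h1 : faceOf (Fin.succ 0) (s.precomp p) = (faceOf 0 s).precomp (p ≫ s.map' 0 1) :=
      δ_one_precomp s p
    have h2 : faceLeft 0 s = homClass k S (s.map' 0 1) := if_pos rfl
    refine Eq.trans ?_ (congrArg (fun t => incl t _) h1.symm)
    refine Eq.trans ?_ (prepend_tmul (faceOf 0 s) (p ≫ s.map' 0 1) _)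
    rw [faceCoeff, h2, Env.tmul_mul_tmul]
    exact congrArg (fun t => prepend _ (Env.tmul t _)) (homClass_comp p (s.map' 0 1)).symm
  | succ j =>
    have h2 : faceLeft j.succ s = 1 := if_neg (Fin.succ_ne_zero j)
    refine Eq.trans ?_ (congrArg (fun t => incl t _) (δ_succ_succ_precomp s p j).symm)
    refine Eq.trans ?_ (prepend_tmul (faceOf j.succ s) _ _)
    rw [faceCoeff, h2, Env.tmul_mul_tmul, mul_one]
    exact congrArg (fun t => prepend _ (Env.tmul t _)) (homClass_comp_eqToHom p _).symm

/-- Face `0` of the prepended string gives back `p ⊗ [s] ⊗ r`, and its face `j + 1` cancels the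
contraction of face `j`, the signs being opposite. An identity `p` needs a separate argument, since
the prepended string is then degenerate. -/
theorem contraction_identity (hC : IsAcyclicCategory (PathCat k S))
    (z : CellularModule k S (n + 1)) :
    cellularD k S (n + 1) (contraction k S (n + 1) z) + contraction k S n (cellularD k S n z) =
      z := by
  suffices h : ((cellularD k S (n + 1)).toAddMonoidHom.comp (contraction k S (n + 1)) +
      (contraction k S n).comp (cellularD k S n).toAddMonoidHom) = AddMonoidHom.id _ from
    DFunLike.congr_fun h z
  refine cellular_addHom_ext_tmul fun ⟨s, hs⟩ a p r => ?_
  change cellularD k S (n + 1) (contraction k S (n + 1) (incl s _)) +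
    contraction k S n (cellularD k S n (incl s _)) = incl s _
  dsimp only at p
  have hface : contraction k S n (cellularD k S n (incl s (Env.tmul (homClass k S p) r))) =
      ∑ j : Fin (n + 2), ((-1 : ℤ) ^ (j : ℕ)) •
        incl (faceOf j.succ (s.precomp p)) (Env.tmul 1 (faceRight j s * r)) := by
    rw [cellularD_incl_of_mem hC hs, map_sum]
    refine Finset.sum_congr rfl fun j _ => ?_
    rw [map_zsmul, contraction_incl hC, prepend_face]
  rw [hface, contraction_incl hC, prepend_tmul]
  by_cases ha : a = s.left
  · subst ha
    have hp : p = 𝟙 _ := hC.hom_self p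
    subst hp
    rw [incl_of_not_mem fun h => (hC.precomp_mem_nonDegenerate_iff hs _).1 h rfl]
    rw [LinearMap.zero_apply, map_zero, zero_add, Fin.sum_univ_succ]
    -- For `p` an identity the first term vanishes, and `s` is recovered from the contraction of its
    -- face `0`; the contractions of the other faces are degenerate.
    have h1 : faceOf (Fin.succ 0) (s.precomp (𝟙 s.left)) = s := by
      refine (δ_one_precomp s _).trans (Eq.trans ?_ (precomp_δ_zero s))
      exact congrArg (fun f => ComposableArrows.precomp (faceOf 0 s) f) (Category.id_comp _)
    have h2 : faceRight 0 s = 1 := if_neg (by simp [Fin.ext_iff])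
    have h3 : incl s (Env.tmul (homClass k S (𝟙 s.left)) r) = incl s (Env.tmul 1 r) :=
      incl_idem_tmul s r
    rw [h1, h2, one_mul, h3, Finset.sum_eq_zero, add_zero]
    · simp
    · intro j _
      have h4 := δ_succ_succ_precomp s (𝟙 s.left) j
      unfold faceOf
      rw [h4, incl_of_not_mem, LinearMap.zero_apply, smul_zero]
      intro h5
      refine (hC.precomp_mem_nonDegenerate_iff (hC.δ_mem_nonDegenerate hs _) _).1 h5 ?_
      exact congrArg s.obj (Fin.succ_succAbove_zero j).symm
  · rw [cellularD_incl_of_mem hC ((hC.precomp_mem_nonDegenerate_iff hs p).2 ha),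
      Fin.sum_univ_succ, faceCoeff_zero_precomp, Env.tmul_mul_tmul, one_mul, one_mul, add_assoc,
      ← Finset.sum_add_distrib, Finset.sum_eq_zero, add_zero]
    · rw [Fin.val_zero, pow_zero, one_smul]
      rfl
    · intro j _
      rw [faceCoeff_succ_precomp, Env.tmul_mul_tmul, one_mul, Fin.val_succ, pow_succ, mul_neg_one,
        neg_smul, neg_add_cancel]

/-- Only the vertex at which `p` starts has an idempotent that does not annihilate `p` from the
left. -/
theorem contractionAug_homClass_mul {a b : PathCat k S} (p : a ⟶ b) (r : QuotAlg k S) :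
    contractionAug k S (homClass k S p * r) =
      incl (ComposableArrows.mk₀ a) (Env.tmul 1 (homClass k S p * r)) := by
  refine (Finset.sum_eq_single (a.as : Q) (fun c _ hc => ?_)
    (fun h => absurd (Finset.mem_univ (α := Q) _) h)).trans rfl
  rw [← incl_mul_endIdem, endIdem_def, Env.tmul_mul_tmul, ← mul_assoc]
  have : idem k S c * homClass k S p = 0 :=
    homClass_mul_of_ne (𝟙 (⟨c⟩ : PathCat k S)) p fun e => hc (by rw [e])
  refine Eq.trans (congrArg (fun t => incl _ (Env.tmul _ (t * r))) this) ?_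
  rw [zero_mul, Env.tmul_zero, map_zero]

/-- For nonidentity `p : a ⟶ v` the boundary of `1 ⊗ [p] ⊗ r` is `p ⊗ [v] ⊗ r - 1 ⊗ [a] ⊗ p r`, and
the subtracted term is the contraction of the product `p r`. -/
theorem contraction_identity_zero (hC : IsAcyclicCategory (PathCat k S))
    (z : CellularModule k S 0) :
    cellularD k S 0 (contraction k S 0 z) + contractionAug k S (cellularAug k S z) = z := by
  suffices h : ((cellularD k S 0).toAddMonoidHom.comp (contraction k S 0) +
      (contractionAug k S).comp (cellularAug k S).toAddMonoidHom) = AddMonoidHom.id _ from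
    DFunLike.congr_fun h z
  refine cellular_addHom_ext_tmul fun ⟨s, hs⟩ a p r => ?_
  change cellularD k S 0 (contraction k S 0 (incl s _)) +
    contractionAug k S (cellularAug k S (incl s _)) = incl s _
  dsimp only at p
  have haug : cellularAug k S (incl s (Env.tmul (homClass k S p) r)) = homClass k S p * r := by
    rw [cellularAug_incl, Env.tmul_smul]
    exact congrArg (· * r) (homClass_mul_idem p)
  rw [haug, contractionAug_homClass_mul, contraction_incl hC, prepend_tmul]
  by_cases ha : a = s.left
  · subst ha
    have hp : p = 𝟙 _ := hC.hom_self p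
    subst hp
    rw [incl_of_not_mem fun h => (hC.precomp_mem_nonDegenerate_iff hs _).1 h rfl,
      LinearMap.zero_apply, map_zero, zero_add]
    have h1 : ComposableArrows.mk₀ s.left = s := ComposableArrows.ext₀ rfl
    rw [h1, homClass_id, incl_idem_tmul]
    refine Eq.trans ?_ (incl_mul_endIdem s _)
    rw [← incl_mul_endIdem, endIdem_def, Env.tmul_mul_tmul, Env.tmul_mul_tmul, ← mul_assoc]
    exact congrArg (fun t => incl s (Env.tmul _ (t * r))) (idem_mul_idem _)
  · rw [cellularD_incl_of_mem hC ((hC.precomp_mem_nonDegenerate_iff hs p).2 ha),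
      Fin.sum_univ_two, faceCoeff_zero_precomp, faceCoeff_one_precomp, Env.tmul_mul_tmul,
      Env.tmul_mul_tmul, one_mul, one_mul, one_mul]
    have h1 : faceOf 1 (s.precomp p) = ComposableArrows.mk₀ a := δ_one_precomp_zero s p
    have h0 : faceOf 0 (s.precomp p) = s := δ_zero_precomp s p
    rw [h0, h1]
    simp

theorem cellularAug_comp_cellularD (hC : IsAcyclicCategory (PathCat k S)) :
    (cellularAug k S).comp (cellularD k S 0) = 0 := by
  refine cellular_hom_ext fun ⟨s, hs⟩ => ?_
  have h0 : faceCoeff 0 s = Env.tmul (homClass k S (s.map' 0 1)) 1 := by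
    unfold faceCoeff faceLeft faceRight
    rw [if_pos rfl, if_neg (by simp)]
  have h1 : faceCoeff 1 s = Env.tmul 1 (homClass k S (s.map' 0 1)) := by
    unfold faceCoeff faceLeft faceRight
    rw [if_neg (by simp), if_pos (by rfl)]
  rw [LinearMap.comp_apply, cellularD_incl_of_mem hC hs, Fin.sum_univ_two, h0, h1]
  have h2 : homClass k S (s.map' 0 1) * idem k S ((faceOf 0 s).obj 0).as =
      homClass k S (s.map' 0 1) := homClass_mul_idem (s.map' 0 1)
  have h3 : idem k S ((faceOf 1 s).obj 0).as * homClass k S (s.map' 0 1) =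
      homClass k S (s.map' 0 1) := idem_mul_homClass (s.map' 0 1)
  simp [cellularAug_incl, Env.tmul_smul, h2, h3]

/-- A string is its tail with the first morphism put back in front. -/
theorem incl_eq_contraction (hC : IsAcyclicCategory (PathCat k S))
    (s : ComposableArrows (PathCat k S) (n + 1)) : ∃ z, incl s 1 = contraction k S n z := by
  refine ⟨incl (faceOf 0 s) (Env.tmul (homClass k S (s.map' 0 1)) 1), ?_⟩
  rw [contraction_incl hC]
  refine Eq.trans ?_ (prepend_tmul (faceOf 0 s) (s.map' 0 1) 1).symm
  exact congrArg (fun t => incl t 1) (precomp_δ_zero s).symm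

/-- No sign computation is needed. On a generator `h z`, two uses of `d h = 1 - h d` turn `d d h z`
into `h (d d z)`, which vanishes by induction; at the bottom the augmentation replaces the second
`d`. -/
theorem cellularD_comp_cellularD (hC : IsAcyclicCategory (PathCat k S)) (n : ℕ) :
    (cellularD k S n).comp (cellularD k S (n + 1)) = 0 := by
  induction n with
  | zero =>
    refine cellular_hom_ext fun σ => ?_
    obtain ⟨z, hz⟩ := incl_eq_contraction hC σ.arrows
    rw [hz, LinearMap.comp_apply, eq_sub_of_add_eq (contraction_identity hC z), map_sub,
      eq_sub_of_add_eq (contraction_identity_zero hC (cellularD k S 0 z)),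
      ← LinearMap.comp_apply (cellularAug k S), cellularAug_comp_cellularD hC]
    simp
  | succ n ih =>
    refine cellular_hom_ext fun σ => ?_
    obtain ⟨z, hz⟩ := incl_eq_contraction hC σ.arrows
    rw [hz, LinearMap.comp_apply, eq_sub_of_add_eq (contraction_identity hC z), map_sub,
      eq_sub_of_add_eq (contraction_identity hC (cellularD k S (n + 1) z)),
      ← LinearMap.comp_apply (cellularD k S n), ih]
    simp

theorem cellularD_exact (hC : IsAcyclicCategory (PathCat k S)) {z : CellularModule k S (n + 1)}
    (hz : cellularD k S n z = 0) : ∃ y, cellularD k S (n + 1) y = z :=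
  ⟨contraction k S (n + 1) z, by
    have := contraction_identity hC z
    rwa [hz, map_zero, add_zero] at this⟩

theorem cellularAug_exact (hC : IsAcyclicCategory (PathCat k S)) {z : CellularModule k S 0}
    (hz : cellularAug k S z = 0) : ∃ y, cellularD k S 0 y = z :=
  ⟨contraction k S 0 z, by
    have := contraction_identity_zero hC z
    rwa [hz, map_zero, add_zero] at this⟩

end Contraction

/-! ### Algebraic discrete Morse theory -/

theorem chainComplex_of_d_succ {V : Type u} [Category.{v} V] [Limits.HasZeroMorphisms V]
    (X : ℕ → V) (d : ∀ n, X (n + 1) ⟶ X n) (sq : ∀ n, d (n + 1) ≫ d n = 0) (n : ℕ) :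
    (ChainComplex.of X d sq).d (n + 1) n = d n :=
  ChainComplex.of_d _ _ _

theorem down_rel_succ (n : ℕ) : (ComplexShape.down ℕ).Rel (n + 1) n := rfl

/-- A complex of modules `C` whose terms are split into a part `K` and the images of two
projections `T` and `B`, with maps `up` that identify the `B`-part with the `T`-part one degree
higher, such that the complex differs from the one with the inverse of `up` as differential by
a nilpotent perturbation.  The map `flow` satisfies the recursion of sums over gradient paths. -/
structure MorseSplitting {R : Type u} [Ring R] (C : ℕ → Type v) (K : ℕ → Type v)
    [∀ n, AddCommGroup (C n)] [∀ n, AddCommGroup (K n)] [∀ n, Module R (C n)]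
    [∀ n, Module R (K n)] (d : ∀ n, C (n + 1) →ₗ[R] C n) where
  ι : ∀ n, K n →ₗ[R] C n
  π : ∀ n, C n →ₗ[R] K n
  T : ∀ n, C n →ₗ[R] C n
  B : ∀ n, C n →ₗ[R] C n
  up : ∀ n, C n →ₗ[R] C (n + 1)
  flow : ∀ n, C (n + 1) →ₗ[R] K n
  π_ι : ∀ n x, π n (ι n x) = x
  sum : ∀ n x, ι n (π n x) + T n x + B n x = x
  π_T : ∀ n x, π n (T n x) = 0
  T_T : ∀ n x, T n (T n x) = T n x
  B_B : ∀ n x, B n (B n x) = B n x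
  B_T : ∀ n x, B n (T n x) = 0
  T_ι : ∀ n x, T n (ι n x) = 0
  B_ι : ∀ n x, B n (ι n x) = 0
  up_B : ∀ n x, up n (B n x) = up n x
  T_up : ∀ n x, T (n + 1) (up n x) = up n x
  exists_up : ∀ n x, ∃ y, up n y = T (n + 1) x
  B_zero : ∀ x, B 0 x = 0
  T_zero : ∀ x, T 0 x = 0
  flow_sub : ∀ n x, flow n x - flow n (T (n + 1) x) = π n (d n x) - flow n (up n (d n x))
  nilpotent : ∀ n, IsNilpotent (B n ∘ₗ d n ∘ₗ up n - B n : Module.End R (C n))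

namespace MorseSplitting

variable {R : Type u} [Ring R] {C : ℕ → Type v} {K : ℕ → Type v}
    [∀ n, AddCommGroup (C n)] [∀ n, AddCommGroup (K n)] [∀ n, Module R (C n)]
    [∀ n, Module R (K n)] {d : ∀ n, C (n + 1) →ₗ[R] C n} (m : MorseSplitting C K d)

/-- The perturbed identity `1 - B + B d up`. -/
def pert (n : ℕ) : Module.End R (C n) := 1 + (m.B n ∘ₗ d n ∘ₗ m.up n - m.B n)

theorem pert_apply (n : ℕ) (x : C n) :
    m.pert n x = x + (m.B n (d n (m.up n x)) - m.B n x) := rfl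

theorem isUnit_pert (n : ℕ) : IsUnit (m.pert n) := (m.nilpotent n).isUnit_one_add

/-- The inverse of the perturbed identity. -/
def pertInv (n : ℕ) : Module.End R (C n) := ↑(m.isUnit_pert n).unit⁻¹

theorem pert_pertInv (n : ℕ) (x : C n) : m.pert n (m.pertInv n x) = x :=
  LinearMap.congr_fun (m.isUnit_pert n).mul_val_inv x

theorem pertInv_pert (n : ℕ) (x : C n) : m.pertInv n (m.pert n x) = x :=
  LinearMap.congr_fun (m.isUnit_pert n).val_inv_mul x

/-- If `E` kills the critical part and `T`, then `E ∘ B = E`; if it also kills `d ∘ up`, then `E ∘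
pert = 0`, and `pert` is invertible. -/
theorem hom_eq_zero {n : ℕ} {X : Type x} [AddCommGroup X] [Module R X] (E : C n →ₗ[R] X)
    (hT : ∀ x, E (m.T n x) = 0) (hι : ∀ x, E (m.ι n x) = 0)
    (hd : ∀ x, E (d n (m.up n x)) = 0) (x : C n) : E x = 0 := by
  have hB : ∀ x, E (m.B n x) = E x := fun x => by
    conv_rhs => rw [← m.sum n x, map_add, map_add, hT, hι, zero_add, zero_add]
  have h : ∀ x, E (m.pert n x) = 0 := fun x => by
    rw [pert_apply, map_add, map_sub, hB, hB, hd, zero_sub, add_neg_cancel]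
  rw [← m.pert_pertInv n x, h]

/-- The inverse of the part of the differential that maps the `T`-part to the `B`-part. -/
def homotopy (n : ℕ) : C n →ₗ[R] C (n + 1) := m.up n ∘ₗ m.pertInv n

theorem homotopy_pert (n : ℕ) (x : C n) : m.homotopy n (m.pert n x) = m.up n x := by
  rw [homotopy, LinearMap.comp_apply, pertInv_pert]

theorem up_T (n : ℕ) (x : C n) : m.up n (m.T n x) = 0 := by
  rw [← up_B, B_T, map_zero]

theorem up_ι (n : ℕ) (x : K n) : m.up n (m.ι n x) = 0 := by
  rw [← up_B, B_ι, map_zero]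

theorem homotopy_T (n : ℕ) (x : C n) : m.homotopy n (m.T n x) = 0 := by
  have h : m.pert n (m.T n x) = m.T n x := by
    rw [pert_apply, up_T, B_T]; simp
  rw [← h, homotopy_pert, up_T]

theorem T_homotopy (n : ℕ) (x : C n) : m.T (n + 1) (m.homotopy n x) = m.homotopy n x :=
  m.T_up n _

theorem B_pert (n : ℕ) (x : C n) : m.B n (m.pert n x) = m.B n (d n (m.up n x)) := by
  rw [pert_apply, map_add, map_sub, B_B, B_B, add_sub_cancel]

theorem pert_B (n : ℕ) (x : C n) : m.pert n (m.B n x) = m.B n (d n (m.up n x)) := by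
  rw [pert_apply, up_B, B_B, add_sub_cancel]

/-- `pert` commutes with `B`, since both composites equal `B d up`. Hence the homotopy sees only the
`B`-part. -/
theorem homotopy_B (n : ℕ) (x : C n) : m.homotopy n (m.B n x) = m.homotopy n x := by
  obtain ⟨y, rfl⟩ : ∃ y, m.pert n y = x := ⟨_, m.pert_pertInv n x⟩
  rw [B_pert, ← pert_B, homotopy_pert, homotopy_pert, up_B]

/-- Elements of `T` are values of `up`, and `h d up = h B d up = h pert B = up B = up`. With
`B_d_homotopy` this makes `h` a two-sided inverse of the component of `d` from `T` to `B`. -/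
theorem homotopy_d_T (n : ℕ) (x : C (n + 1)) :
    m.homotopy n (d n (m.T (n + 1) x)) = m.T (n + 1) x := by
  obtain ⟨y, hy⟩ := m.exists_up n x
  rw [← hy, ← homotopy_B, ← pert_B, homotopy_pert, up_B]

theorem homotopy_zero (x : C 0) : m.homotopy 0 x = 0 := by
  rw [← homotopy_B, B_zero, map_zero]

theorem hom_eq_zero' {n : ℕ} {X : Type x} [AddCommGroup X] [Module R X] (E : C n →ₗ[R] X)
    (hT : ∀ x, E (m.T n x) = 0) (hι : ∀ x, E (m.ι n x) = 0)
    (hd : ∀ x, E (d n (m.homotopy n x)) = 0) (x : C n) : E x = 0 :=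
  m.hom_eq_zero E hT hι (fun x => by rw [← homotopy_pert, hd]) x

theorem B_d_homotopy (n : ℕ) (x : C n) : m.B n (d n (m.homotopy n x)) = m.B n x := by
  rw [homotopy, LinearMap.comp_apply, ← B_pert, pert_pertInv]

/-- The differential of the Morse complex. -/
def δ (n : ℕ) : K (n + 1) →ₗ[R] K n := m.flow n ∘ₗ m.ι (n + 1)

/-- The projection to the Morse complex. -/
def proj (n : ℕ) : C n →ₗ[R] K n := m.π n - m.flow n ∘ₗ m.up n

theorem proj_apply (n : ℕ) (x : C n) : m.proj n x = m.π n x - m.flow n (m.up n x) := rfl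

theorem proj_zero (x : C 0) : m.proj 0 x = m.π 0 x := by
  rw [proj_apply, ← m.up_B, m.B_zero, map_zero, map_zero, sub_zero]

/-- The recursion for `flow`, read through `proj`. On `T` it says that `proj ∘ d` vanishes; on the
critical part it yields `δ`. -/
theorem proj_d (n : ℕ) (x : C (n + 1)) :
    m.proj n (d n x) = m.flow n x - m.flow n (m.T (n + 1) x) :=
  (m.flow_sub n x).symm

theorem proj_T (n : ℕ) (x : C n) : m.proj n (m.T n x) = 0 := by
  rw [proj_apply, π_T, up_T, map_zero, sub_zero]

theorem proj_ι (n : ℕ) (x : K n) : m.proj n (m.ι n x) = x := by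
  rw [proj_apply, π_ι, up_ι, map_zero, sub_zero]

theorem proj_d_T (n : ℕ) (x : C (n + 1)) : m.proj n (d n (m.T (n + 1) x)) = 0 := by
  rw [proj_d, T_T, sub_self]

theorem proj_homotopy (n : ℕ) (x : C n) : m.proj (n + 1) (m.homotopy n x) = 0 := by
  rw [← T_homotopy, proj_T]

theorem proj_d_homotopy (n : ℕ) (x : C n) : m.proj n (d n (m.homotopy n x)) = 0 := by
  rw [← T_homotopy, proj_d_T]

/-- Tested on the three generating pieces: both sides vanish on `T` and on `d ∘ up`, and they agree
on the critical part by the definition of `δ`. -/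
theorem δ_proj (hd : ∀ n x, d n (d (n + 1) x) = 0) (n : ℕ) (x : C (n + 1)) :
    m.δ n (m.proj (n + 1) x) = m.proj n (d n x) := by
  rw [eq_comm, ← sub_eq_zero]
  refine m.hom_eq_zero (m.proj n ∘ₗ d n - m.δ n ∘ₗ m.proj (n + 1)) (fun x => ?_) (fun x => ?_)
    (fun x => ?_) x
  · simp [proj_d_T, proj_T]
  · simp [proj_d, proj_ι, T_ι, δ]
  · simp only [LinearMap.sub_apply, LinearMap.comp_apply, hd]
    rw [← T_up, proj_d_T]
    simp

theorem δ_δ (hd : ∀ n x, d n (d (n + 1) x) = 0) (n : ℕ) (x : K (n + 2)) :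
    m.δ n (m.δ (n + 1) x) = 0 := by
  rw [← m.proj_ι (n + 2) x, m.δ_proj hd, m.δ_proj hd, hd, map_zero]

/-- The homotopy projection in positive degrees. -/
def retract (n : ℕ) : C (n + 1) →ₗ[R] C (n + 1) :=
  LinearMap.id - d (n + 1) ∘ₗ m.homotopy (n + 1) - m.homotopy n ∘ₗ d n

theorem retract_apply (n : ℕ) (x : C (n + 1)) :
    m.retract n x = x - d (n + 1) (m.homotopy (n + 1) x) - m.homotopy n (d n x) := rfl

/-- The inclusion of the Morse complex. -/
def incl : ∀ n, K n →ₗ[R] C n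
  | 0 => m.ι 0
  | n + 1 => m.retract n ∘ₗ m.ι (n + 1)

theorem retract_T (n : ℕ) (x : C (n + 1)) : m.retract n (m.T (n + 1) x) = 0 := by
  rw [retract_apply, homotopy_T, homotopy_d_T]
  simp

/-- Follows from `h d h = h` and `d d = 0`. -/
theorem retract_d_homotopy (hd : ∀ n x, d n (d (n + 1) x) = 0) (n : ℕ) (x : C (n + 1)) :
    m.retract n (d (n + 1) (m.homotopy (n + 1) x)) = 0 := by
  have h : m.homotopy (n + 1) (d (n + 1) (m.homotopy (n + 1) x)) = m.homotopy (n + 1) x := by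
    rw [← homotopy_B, B_d_homotopy, homotopy_B]
  rw [retract_apply, h, hd]
  simp

/-- This is `incl ∘ proj = 1 - d h - h d` in positive degrees: the retraction kills `T` and `d h`,
so it depends only on the Morse projection. -/
theorem retract_ι_proj (hd : ∀ n x, d n (d (n + 1) x) = 0) (n : ℕ) (x : C (n + 1)) :
    m.retract n (m.ι (n + 1) (m.proj (n + 1) x)) = m.retract n x := by
  rw [← sub_eq_zero]
  refine m.hom_eq_zero' (m.retract n ∘ₗ m.ι (n + 1) ∘ₗ m.proj (n + 1) - m.retract n)
    (fun x => ?_) (fun x => ?_) (fun x => ?_) x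
  · simp [proj_T, retract_T]
  · simp [proj_ι]
  · simp [proj_d_homotopy, m.retract_d_homotopy hd]

theorem ι_proj_zero (x : C 0) : m.ι 0 (m.proj 0 x) = x := by
  conv_rhs => rw [← m.sum 0 x, T_zero, B_zero, add_zero, add_zero]
  rw [proj_zero]

theorem proj_incl : ∀ (n : ℕ) (x : K n), m.proj n (m.incl n x) = x
  | 0, x => m.proj_ι 0 x
  | n + 1, x => by
    rw [incl, LinearMap.comp_apply, retract_apply, map_sub, map_sub, proj_d_homotopy,
      proj_homotopy, proj_ι, sub_zero, sub_zero]

/-- Since `δ = proj ∘ d ∘ ι`, the left side in positive degrees is the retraction of `d (ι x)`. Both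
sides then equal `d ι x - d h d ι x` because `d d = 0`. -/
theorem incl_δ (hd : ∀ n x, d n (d (n + 1) x) = 0) :
    ∀ (n : ℕ) (x : K (n + 1)), m.incl n (m.δ n x) = d n (m.incl (n + 1) x) := by
  have h : ∀ n (x : K (n + 1)), m.δ n x = m.proj n (d n (m.ι (n + 1) x)) := fun n x => by
    rw [← m.δ_proj hd, proj_ι]
  rintro (_ | n) x
  · rw [h, incl, ι_proj_zero, incl, LinearMap.comp_apply, retract_apply, map_sub, map_sub, hd,
      homotopy_zero, map_zero, sub_zero, sub_zero]
  · rw [h, incl, LinearMap.comp_apply, m.retract_ι_proj hd, incl, LinearMap.comp_apply,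
      retract_apply, retract_apply, map_sub, map_sub, hd, hd, map_zero, sub_zero, sub_zero]

/-! ### The homotopy equivalence of chain complexes -/

section Complex

variable (sqC : ∀ n, ModuleCat.ofHom (d (n + 1)) ≫ ModuleCat.ofHom (d n) = 0)
  (sqK : ∀ n, ModuleCat.ofHom (m.δ (n + 1)) ≫ ModuleCat.ofHom (m.δ n) = 0)

theorem d_d_of_comp (sqC : ∀ n, ModuleCat.ofHom (d (n + 1)) ≫ ModuleCat.ofHom (d n) = 0)
    (n : ℕ) (x : C (n + 2)) : d n (d (n + 1) x) = 0 :=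
  LinearMap.congr_fun (congrArg ModuleCat.Hom.hom (sqC n)) x

/-- The projection to the Morse complex as a map of complexes. -/
def projHom : ChainComplex.of (fun n => ModuleCat.of R (C n)) (fun n => ModuleCat.ofHom (d n)) sqC ⟶
    ChainComplex.of (fun n => ModuleCat.of R (K n)) (fun n => ModuleCat.ofHom (m.δ n)) sqK :=
  ChainComplex.ofHom (fun n => ModuleCat.ofHom (m.proj n)) fun n => by
    rw [chainComplex_of_d_succ, chainComplex_of_d_succ]
    exact ModuleCat.hom_ext (LinearMap.ext fun x => m.δ_proj (d_d_of_comp sqC) n x)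

/-- The inclusion of the Morse complex as a map of complexes. -/
def inclHom :
    ChainComplex.of (fun n => ModuleCat.of R (K n)) (fun n => ModuleCat.ofHom (m.δ n)) sqK ⟶
    ChainComplex.of (fun n => ModuleCat.of R (C n)) (fun n => ModuleCat.ofHom (d n)) sqC :=
  ChainComplex.ofHom (fun n => ModuleCat.ofHom (m.incl n)) fun n => by
    rw [chainComplex_of_d_succ, chainComplex_of_d_succ]
    exact ModuleCat.hom_ext (LinearMap.ext fun x => (m.incl_δ (d_d_of_comp sqC) n x).symm)

theorem inclHom_projHom : m.inclHom sqC sqK ≫ m.projHom sqC sqK = 𝟙 _ :=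
  HomologicalComplex.hom_ext _ _ fun n =>
    ModuleCat.hom_ext (LinearMap.ext fun x => m.proj_incl n x)

/-- The components of the homotopy. -/
def homotopyMap (i j : ℕ) (h : (ComplexShape.down ℕ).Rel j i) :
    (ModuleCat.of R (C i) : ModuleCat R) ⟶ ModuleCat.of R (C j) :=
  -- The sign is negative because `incl ∘ proj - 1 = -(d h + h d)`.
  ModuleCat.ofHom (-m.homotopy i) ≫ eqToHom (by rw [show i + 1 = j from h])

theorem homotopyMap_succ (i : ℕ) (h : (ComplexShape.down ℕ).Rel (i + 1) i) :
    m.homotopyMap i (i + 1) h = ModuleCat.ofHom (-m.homotopy i) := by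
  rw [homotopyMap, eqToHom_refl, Category.comp_id]

theorem projHom_inclHom_sub : m.projHom sqC sqK ≫ m.inclHom sqC sqK - 𝟙 _ =
    Homotopy.nullHomotopicMap' m.homotopyMap := by
  refine HomologicalComplex.hom_ext _ _ fun n => ?_
  obtain _ | n := n
  · rw [Homotopy.nullHomotopicMap'_f_of_not_rel_left (down_rel_succ 0) (by simp),
      homotopyMap_succ, chainComplex_of_d_succ]
    refine ModuleCat.hom_ext (LinearMap.ext fun x => ?_)
    change m.ι 0 (m.proj 0 x) - x = d 0 (-m.homotopy 0 x)
    rw [ι_proj_zero, homotopy_zero]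
    simp
  · rw [Homotopy.nullHomotopicMap'_f (down_rel_succ (n + 1)) (down_rel_succ n),
      homotopyMap_succ, homotopyMap_succ, chainComplex_of_d_succ,
      chainComplex_of_d_succ]
    refine ModuleCat.hom_ext (LinearMap.ext fun x => ?_)
    change m.retract n (m.ι (n + 1) (m.proj (n + 1) x)) - x =
      -m.homotopy n (d n x) + d (n + 1) (-m.homotopy (n + 1) x)
    rw [m.retract_ι_proj (d_d_of_comp sqC), retract_apply, map_neg]
    abel

/-- The complex is homotopy equivalent to its Morse complex. -/
def homotopyEquiv : HomotopyEquiv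
    (ChainComplex.of (fun n => ModuleCat.of R (C n)) (fun n => ModuleCat.ofHom (d n)) sqC)
    (ChainComplex.of (fun n => ModuleCat.of R (K n)) (fun n => ModuleCat.ofHom (m.δ n)) sqK) where
  hom := m.projHom sqC sqK
  inv := m.inclHom sqC sqK
  homotopyHomInvId := (Homotopy.equivSubZero).symm
    ((Homotopy.ofEq (m.projHom_inclHom_sub sqC sqK)).trans (Homotopy.nullHomotopy' _))
  homotopyInvHomId := Homotopy.ofEq (m.inclHom_projHom sqC sqK)

theorem quasiIso_projHom : QuasiIso (m.projHom sqC sqK) :=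
  (m.homotopyEquiv sqC sqK).quasiIso_hom

end Complex

end MorseSplitting

/-! ### Matchings on an acyclic category -/

namespace Matching

open scoped Classical

variable {k : Type w} [CommRing k] {Q : Type u} [Quiver.{v} Q] [Fintype Q] {S : PathRelations Q}
variable (M : Matching k S) {n : ℕ}

/-- The face of a cell as a cell. -/
def faceCell (hC : IsAcyclicCategory (PathCat k S)) (i : Fin (n + 2)) (σ : Cell k S (n + 1)) :
    Cell k S n :=
  ⟨faceOf i σ.arrows, hC.δ_mem_nonDegenerate σ.nonDegenerate i⟩

theorem eq_faceCell (hC : IsAcyclicCategory (PathCat k S)) {i : Fin (n + 2)}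
    {σ : Cell k S (n + 1)} {τ : Cell k S n} (h : σ.face i = τ.arrows) : τ = faceCell hC i σ :=
  Cell.ext h.symm

theorem face_injective (hC : IsAcyclicCategory (PathCat k S)) {σ : Cell k S (n + 1)}
    {i j : Fin (n + 2)} (h : σ.face i = σ.face j) : i = j :=
  hC.δ_injective σ.nonDegenerate h

variable {M} in
theorem IsInternal.endIdem_eq (hM : M.IsInternal) {σ : Cell k S (n + 1)} {τ : Cell k S n}
    (h : M.pair σ τ) : endIdem σ.arrows = endIdem τ.arrows :=
  congrArg₂ (envIdem k S) (hM.start_eq h) (hM.finish_eq h)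

variable {M} in
-- Omitting the first or last vertex would change an endpoint, as the objects of a cell are
-- distinct. An internal pair therefore omits an inner vertex, and nothing is cut off.
theorem IsInternal.faceCoeff_eq_one (hM : M.IsInternal) (hC : IsAcyclicCategory (PathCat k S))
    {σ : Cell k S (n + 1)} {τ : Cell k S n} (h : M.pair σ τ) {i : Fin (n + 2)}
    (hi : σ.face i = τ.arrows) : faceCoeff i σ.arrows = 1 := by
  have hinj := (hC.mem_nonDegenerate_iff _).1 σ.nonDegenerate
  have h0 : i ≠ 0 := by
    rintro rfl
    have h1 : σ.arrows.obj 0 = σ.arrows.obj 1 := by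
      have h2 := hM.start_eq h
      rw [Cell.start, Cell.start, ← hi] at h2
      exact congrArg (fun v : Q => (⟨v⟩ : PathCat k S)) h2
    have := hinj h1
    simp at this
  have h1 : i ≠ Fin.last (n + 1) := by
    rintro rfl
    have h1 : σ.arrows.obj (Fin.last (n + 1)) =
        σ.arrows.obj ((Fin.last (n + 1)).succAbove (Fin.last n)) := by
      have h2 := hM.finish_eq h
      rw [Cell.finish, Cell.finish, ← hi] at h2
      exact congrArg (fun v : Q => (⟨v⟩ : PathCat k S)) h2
    exact Fin.succAbove_ne _ _ (hinj h1).symm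
  rw [faceCoeff, faceLeft, faceRight, if_neg h0, if_neg h1]
  rfl

theorem not_isTop_of_isBottom {σ : Cell k S n} (h : M.IsBottom σ) : ¬ M.IsTop σ := by
  obtain ⟨ρ, hρ⟩ := h
  obtain _ | n := n
  · exact id
  · rintro ⟨τ, hτ⟩
    exact M.top_bottom_disjoint hρ hτ

theorem isTop_of_pair {σ : Cell k S (n + 1)} {τ : Cell k S n} (h : M.pair σ τ) : M.IsTop σ :=
  ⟨τ, h⟩

variable {M} in
/-- The larger cell of the pair containing `τ`. -/
def IsBottom.top {τ : Cell k S n} (h : M.IsBottom τ) : Cell k S (n + 1) := h.choose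

variable {M} in
theorem IsBottom.pair {τ : Cell k S n} (h : M.IsBottom τ) : M.pair h.top τ := h.choose_spec

variable {M} in
/-- The index of `τ` as a face of the larger cell of its pair. -/
def IsBottom.index {τ : Cell k S n} (h : M.IsBottom τ) : Fin (n + 2) := (M.facet h.pair).choose

variable {M} in
theorem IsBottom.face_index {τ : Cell k S n} (h : M.IsBottom τ) : h.top.face h.index = τ.arrows :=
  (M.facet h.pair).choose_spec

/-! ### Maps of the splitting -/

/-- The map `y ↦ y ⊗ [σ]` to the Morse module; it is zero if `σ` is not critical. -/
def critIncl (σ : Cell k S n) : Env k S →ₗ[Env k S] M.MorseModule n :=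
  if h : M.IsCritical σ then
    (DirectSum.lof (Env k S) _ (fun τ : {τ : Cell k S n // M.IsCritical τ} => τ.1.proj)
      ⟨σ, h⟩).comp
      (LinearMap.toSpanSingleton (Env k S) σ.proj
        ⟨endIdem σ.arrows, Submodule.subset_span rfl⟩)
  else 0

theorem critIncl_of_critical {σ : Cell k S n} (h : M.IsCritical σ) (y : Env k S) :
    M.critIncl σ y = DirectSum.lof (Env k S) _
      (fun τ : {τ : Cell k S n // M.IsCritical τ} => τ.1.proj) ⟨σ, h⟩
        ⟨y * endIdem σ.arrows, mul_envIdem_mem _ _ y⟩ := by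
  rw [critIncl, dif_pos h]
  rfl

theorem critIncl_of_not_critical {σ : Cell k S n} (h : ¬ M.IsCritical σ) (y : Env k S) :
    M.critIncl σ y = 0 := by
  rw [critIncl, dif_neg h]
  rfl

theorem critIncl_eq_smul (σ : Cell k S n) (y : Env k S) :
    M.critIncl σ y = y • M.critIncl σ 1 := by
  rw [← map_smul, smul_eq_mul, mul_one]

theorem lof_eq_critIncl (σ : {τ : Cell k S n // M.IsCritical τ}) (y : σ.1.proj) :
    DirectSum.lof (Env k S) _ (fun τ : {τ : Cell k S n // M.IsCritical τ} => τ.1.proj) σ y =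
      M.critIncl σ.1 y := by
  rw [M.critIncl_of_critical σ.2]
  congr 1
  exact Subtype.ext (mul_envIdem_of_mem y.2).symm

theorem endIdem_smul_critIncl_one (σ : Cell k S n) :
    endIdem σ.arrows • M.critIncl σ 1 = M.critIncl σ 1 := by
  by_cases h : M.IsCritical σ
  · rw [← critIncl_eq_smul, M.critIncl_of_critical h, M.critIncl_of_critical h]
    congr 1
    exact Subtype.ext (by simp only [one_mul, endIdem_mul_self])
  · rw [M.critIncl_of_not_critical h, smul_zero]

theorem morse_hom_ext {X : Type x} [AddCommGroup X] [Module (Env k S) X]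
    {f g : M.MorseModule n →ₗ[Env k S] X}
    (h : ∀ σ : Cell k S n, M.IsCritical σ → f (M.critIncl σ 1) = g (M.critIncl σ 1)) : f = g := by
  refine DirectSum.linearMap_ext _ fun σ => LinearMap.ext fun y => ?_
  rw [LinearMap.comp_apply, LinearMap.comp_apply, lof_eq_critIncl, critIncl_eq_smul, map_smul,
    map_smul, h σ.1 σ.2]

/-- The linear map on the Morse module with prescribed values on generators. -/
def morseDesc {X : Type x} [AddCommGroup X] [Module (Env k S) X] (c : Cell k S n → X) :
    M.MorseModule n →ₗ[Env k S] X :=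
  DirectSum.toModule _ _ _ fun σ =>
    (LinearMap.toSpanSingleton (Env k S) X (c σ.1)).comp (σ.1.proj).subtype

theorem morseDesc_critIncl {X : Type x} [AddCommGroup X] [Module (Env k S) X]
    (c : Cell k S n → X) {σ : Cell k S n} (h : M.IsCritical σ) :
    M.morseDesc c (M.critIncl σ 1) = endIdem σ.arrows • c σ := by
  rw [critIncl_of_critical _ h, morseDesc, DirectSum.toModule_lof]
  change (1 * endIdem σ.arrows) • c σ = _
  rw [one_mul]

variable (n)

/-- The inclusion of the critical part. -/
def critι : M.MorseModule n →ₗ[Env k S] CellularModule k S n :=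
  M.morseDesc fun σ => incl σ.arrows 1

/-- The projection to the critical part. -/
def critπ : CellularModule k S n →ₗ[Env k S] M.MorseModule n :=
  cellDesc fun σ => M.critIncl σ 1

/-- The projection to the part spanned by the larger cells of pairs. -/
def topProj : CellularModule k S n →ₗ[Env k S] CellularModule k S n :=
  cellDesc fun σ => if M.IsTop σ then incl σ.arrows 1 else 0

/-- The projection to the part spanned by the smaller cells of pairs. -/
def bottomProj : CellularModule k S n →ₗ[Env k S] CellularModule k S n :=
  cellDesc fun σ => if M.IsBottom σ then incl σ.arrows 1 else 0

/-- The map that sends the smaller cell of a pair to the larger one, up to sign. -/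
def upMap : CellularModule k S n →ₗ[Env k S] CellularModule k S (n + 1) :=
  cellDesc fun τ => if h : M.IsBottom τ then
    ((-1 : ℤ) ^ (h.index : ℕ)) • incl h.top.arrows 1 else 0

variable {n}

theorem critι_critIncl {σ : Cell k S n} (h : M.IsCritical σ) :
    M.critι n (M.critIncl σ 1) = incl σ.arrows 1 := by
  rw [critι, morseDesc_critIncl _ _ h, endIdem_smul_incl_one]

theorem critπ_incl (σ : Cell k S n) : M.critπ n (incl σ.arrows 1) = M.critIncl σ 1 := by
  rw [critπ, cellDesc_incl_one, endIdem_smul_critIncl_one]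

theorem topProj_incl (σ : Cell k S n) :
    M.topProj n (incl σ.arrows 1) = if M.IsTop σ then incl σ.arrows 1 else 0 := by
  rw [topProj, cellDesc_incl_one, smul_ite, smul_zero, endIdem_smul_incl_one]

theorem bottomProj_incl (σ : Cell k S n) :
    M.bottomProj n (incl σ.arrows 1) = if M.IsBottom σ then incl σ.arrows 1 else 0 := by
  rw [bottomProj, cellDesc_incl_one, smul_ite, smul_zero, endIdem_smul_incl_one]

theorem upMap_incl (hM : M.IsInternal) {τ : Cell k S n} (h : M.IsBottom τ) :
    M.upMap n (incl τ.arrows 1) = ((-1 : ℤ) ^ (h.index : ℕ)) • incl h.top.arrows 1 := by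
  rw [upMap, cellDesc_incl_one, dif_pos h, smul_comm, ← hM.endIdem_eq h.pair,
    endIdem_smul_incl_one]

theorem upMap_incl_of_not {τ : Cell k S n} (h : ¬ M.IsBottom τ) :
    M.upMap n (incl τ.arrows 1) = 0 := by
  rw [upMap, cellDesc_incl_one, dif_neg h, smul_zero]

/-! ### Acyclicity -/

variable {M}

/-- The relation "reachable from" between cells of the same dimension. -/
def Reach (M : Matching k S) (τ σ : Cell k S n) : Prop :=
  Relation.TransGen M.Arrow ⟨n, σ⟩ ⟨n, τ⟩

theorem IsAcyclic.wellFounded (hM : M.IsAcyclic) [Finite (Cell k S n)] :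
    WellFounded (M.Reach (n := n)) := by
  have : IsTrans (Cell k S n) M.Reach := ⟨fun _ _ _ h h' => h'.trans h⟩
  have : Std.Irrefl (M.Reach (n := n)) := ⟨fun x h => hM _ h⟩
  exact Finite.wellFounded_of_trans_of_irrefl _

/-- The number of cells of the same dimension that are reachable from a cell. -/
def reachRank (M : Matching k S) (σ : Cell k S n) : ℕ := {τ | M.Reach τ σ}.ncard

/-- Whatever is reachable from `τ` is reachable from `σ`, while `τ` is reachable from `σ` but not
from itself. -/
theorem IsAcyclic.reachRank_lt (hM : M.IsAcyclic) [Finite (Cell k S n)] {τ σ : Cell k S n}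
    (h : M.Reach τ σ) : M.reachRank τ < M.reachRank σ := by
  refine Set.ncard_lt_ncard ⟨fun ρ hρ => Relation.TransGen.trans h hρ, fun hsub => ?_⟩
    (Set.toFinite _)
  exact hM _ (hsub h)

theorem reach_of_pair_of_face (hC : IsAcyclicCategory (PathCat k S)) {σ : Cell k S (n + 1)}
    {τ : Cell k S n} (h : M.pair σ τ) {i : Fin (n + 2)} (hi : ¬ M.pair σ (faceCell hC i σ)) :
    M.Reach (faceCell hC i σ) τ :=
  .tail (.single (.up σ τ h)) (.down σ _ i rfl hi)

theorem reach_top (hC : IsAcyclicCategory (PathCat k S)) {σ : Cell k S (n + 1)}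
    {i : Fin (n + 2)} (hi : ¬ M.pair σ (faceCell hC i σ)) (h : M.IsBottom (faceCell hC i σ)) :
    M.Reach h.top σ :=
  .tail (.single (.down σ _ i rfl hi)) (.up _ _ h.pair)

/-- Each application of `ν` passes to cells of strictly smaller `reachRank`, and the rank is bounded
by the number of cells. -/
theorem isNilpotent_of_reach (hM : M.IsAcyclic) [Finite (Cell k S n)]
    (ν : Module.End (Env k S) (CellularModule k S n))
    (hν : ∀ σ : Cell k S n, ν (incl σ.arrows 1) ∈
      Submodule.span (Env k S) {z | ∃ τ : Cell k S n, M.Reach τ σ ∧ incl τ.arrows 1 = z}) :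
    IsNilpotent ν := by
  have key : ∀ (m : ℕ) (σ : Cell k S n), M.reachRank σ < m → (ν ^ m) (incl σ.arrows 1) = 0 := by
    intro m
    induction m with
    | zero => intro σ h; omega
    | succ m ih =>
      intro σ h
      rw [pow_succ, Module.End.mul_apply]
      have hle : Submodule.span (Env k S)
          {z | ∃ τ : Cell k S n, M.Reach τ σ ∧ incl τ.arrows 1 = z} ≤ LinearMap.ker (ν ^ m) := by
        rw [Submodule.span_le]
        rintro _ ⟨τ, hτ, rfl⟩
        exact ih τ (by have := hM.reachRank_lt hτ; omega)
      exact hle (hν σ)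
  refine ⟨Nat.card (Cell k S n) + 1, cellular_hom_ext fun σ => key _ σ ?_⟩
  have : M.reachRank σ ≤ Nat.card (Cell k S n) := by
    rw [reachRank, ← Set.ncard_univ]
    exact Set.ncard_le_ncard (Set.subset_univ _) (Set.toFinite _)
  omega

end Matching

namespace Matching

open scoped Classical

variable {k : Type w} [CommRing k] {Q : Type u} [Quiver.{v} Q] [Fintype Q] {S : PathRelations Q}
variable {M : Matching k S} {n : ℕ}

/-! ### Gradient paths -/

/-- The index of the first downward arrow of a gradient path. -/
def GradientPath.firstIndex {τ : Cell k S n} {σ : Cell k S (n + 1)} :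
    M.GradientPath τ σ → Fin (n + 2)
  | .last i _ _ => i
  | .step _ i _ _ _ _ _ _ => i

/-- A gradient path either is a single downward arrow, or starts with a zigzag through a matched
pair. -/
def gradientPathOf (hC : IsAcyclicCategory (PathCat k S)) (τ : Cell k S n) (σ : Cell k S (n + 1)) :
    ({i : Fin (n + 2) // faceCell hC i σ = τ ∧ ¬ M.pair σ τ} ⊕
      Σ i : {i : Fin (n + 2) // ¬ M.pair σ (faceCell hC i σ) ∧ M.IsBottom (faceCell hC i σ)},
        M.GradientPath τ i.2.2.top) → M.GradientPath τ σ
  | .inl i => .last i.1 (congrArg Cell.arrows i.2.1) i.2.2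
  | .inr ⟨i, γ⟩ => .step (faceCell hC i.1 σ) i.1 rfl i.2.1 i.2.2.index i.2.2.face_index i.2.2.pair γ

/-- The first omitted index determines the face, the matching determines the cell above it, and
distinctness of faces determines the index of the upward arrow. Only the remaining path is free. -/
theorem gradientPathOf_bijective (hC : IsAcyclicCategory (PathCat k S)) (τ : Cell k S n)
    (σ : Cell k S (n + 1)) : Function.Bijective (gradientPathOf (M := M) hC τ σ) := by
  constructor
  · rintro (⟨i, hi⟩ | ⟨⟨i, hi⟩, γ⟩) (⟨j, hj⟩ | ⟨⟨j, hj⟩, γ'⟩) h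
    · cases h
      rfl
    · cases h
    · cases h
    · have hij : i = j := congrArg GradientPath.firstIndex h
      subst hij
      rw [eq_of_heq (GradientPath.step.inj h).2.2.2.2]
  · intro γ
    cases γ with
    | last i h hM => exact ⟨.inl ⟨i, (eq_faceCell hC h).symm, hM⟩, rfl⟩
    | @step _ σ' ρ i h hM j h' hM' γ =>
      obtain rfl := eq_faceCell hC h
      have hb : M.IsBottom (faceCell hC i σ) := ⟨σ', hM'⟩
      obtain rfl : σ' = hb.top := M.top_unique hM' hb.pair
      obtain rfl : j = hb.index := face_injective hC (h'.trans hb.face_index.symm)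
      exact ⟨.inr ⟨⟨i, hM, hb⟩, γ⟩, rfl⟩

theorem IsAcyclic.finite_gradientPath (hM : M.IsAcyclic) (hC : IsAcyclicCategory (PathCat k S))
    [∀ n, Finite (Cell k S n)] (τ : Cell k S n) (σ : Cell k S (n + 1)) :
    Finite (M.GradientPath τ σ) := by
  induction σ using hM.wellFounded.induction with | _ σ ih
  have : ∀ i : {i : Fin (n + 2) // ¬ M.pair σ (faceCell hC i σ) ∧ M.IsBottom (faceCell hC i σ)},
      Finite (M.GradientPath τ i.2.2.top) := fun i => ih _ (reach_top hC i.2.1 i.2.2)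
  exact Finite.of_surjective _ (gradientPathOf_bijective hC τ σ).2

/-- The contribution of a gradient path to the Morse differential. -/
def GradientPath.weight {τ : Cell k S n} {σ : Cell k S (n + 1)} (γ : M.GradientPath τ σ) :
    M.MorseModule n :=
  γ.sign • M.critIncl τ (Env.tmul γ.left γ.right)

variable (M) in
/-- The sum of the contributions of all gradient paths from a cell to critical cells. -/
def flowVal (σ : Cell k S (n + 1)) : M.MorseModule n :=
  ∑ᶠ τ : {τ : Cell k S n // M.IsCritical τ}, ∑ᶠ γ : M.GradientPath τ.1 σ, γ.weight

variable (M n) in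
/-- The linear extension of the sum of the contributions of all gradient paths. -/
def flowMap : CellularModule k S (n + 1) →ₗ[Env k S] M.MorseModule n :=
  cellDesc M.flowVal

theorem flowMap_incl (σ : Cell k S (n + 1)) :
    M.flowMap n (incl σ.arrows 1) = endIdem σ.arrows • M.flowVal σ := by
  rw [flowMap, cellDesc_incl_one]

theorem sum_subtype_eq_sum_dite {ι : Type*} [Fintype ι] {A : Type*} [AddCommMonoid A]
    (p : ι → Prop) [DecidablePred p] [Fintype {i // p i}] (f : {i // p i} → A) :
    ∑ i : {i // p i}, f i = ∑ i, if h : p i then f ⟨i, h⟩ else 0 := by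
  have h1 : ∀ i : {i // p i}, f i = if h : p i.1 then f ⟨i.1, h⟩ else 0 := fun i => by
    rw [dif_pos i.2]
  rw [Finset.sum_congr rfl fun i _ => h1 i,
    ← Finset.sum_subtype (Finset.univ.filter p) (by simp) fun i => if h : p i then f ⟨i, h⟩ else 0]
  refine Finset.sum_filter_of_ne fun i _ hi => ?_
  by_contra h
  exact hi (dif_neg h)

variable (M) in
/-- The contribution of the upward arrow from a cell. -/
def upVal (ρ : Cell k S n) : M.MorseModule n :=
  if h : M.IsBottom ρ then ((-1 : ℤ) ^ (h.index : ℕ)) • M.flowVal h.top else 0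

theorem weight_last (hC : IsAcyclicCategory (PathCat k S)) (τ : Cell k S n) (σ : Cell k S (n + 1))
    (i : {i : Fin (n + 2) // faceCell hC i σ = τ ∧ ¬ M.pair σ τ}) :
    (gradientPathOf hC τ σ (.inl i)).weight =
      ((-1 : ℤ) ^ (i.1 : ℕ)) • faceCoeff i.1 σ.arrows • M.critIncl τ 1 := by
  rw [← critIncl_eq_smul]
  rfl

/-- Left coefficients are appended on the inside and right ones in reverse order, which is
multiplication in `A ⊗ Aᵒᵖ`. The minus sign comes from the upward arrow. -/
theorem weight_step (hC : IsAcyclicCategory (PathCat k S)) (τ : Cell k S n) (σ : Cell k S (n + 1))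
    (i : {i : Fin (n + 2) // ¬ M.pair σ (faceCell hC i σ) ∧ M.IsBottom (faceCell hC i σ)})
    (γ : M.GradientPath τ i.2.2.top) :
    (gradientPathOf hC τ σ (.inr ⟨i, γ⟩)).weight =
      -(((-1 : ℤ) ^ (i.1 : ℕ)) • faceCoeff i.1 σ.arrows •
        ((-1 : ℤ) ^ (i.2.2.index : ℕ)) • γ.weight) := by
  have h : Env.tmul (faceLeft i.1 σ.arrows * γ.left) (γ.right * faceRight i.1 σ.arrows) =
      faceCoeff i.1 σ.arrows * Env.tmul γ.left γ.right := (Env.tmul_mul_tmul _ _ _ _).symm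
  change ((-1) ^ (i.1 : ℕ) * (-(-1) ^ (i.2.2.index : ℕ)) * γ.sign : ℤ) •
    M.critIncl τ (Env.tmul (faceLeft i.1 σ.arrows * γ.left) (γ.right * faceRight i.1 σ.arrows)) = _
  have h' : M.critIncl τ (faceCoeff i.1 σ.arrows * Env.tmul γ.left γ.right) =
      faceCoeff i.1 σ.arrows • M.critIncl τ (Env.tmul γ.left γ.right) := by
    rw [← smul_eq_mul, map_smul]
  rw [h, h', GradientPath.weight,
    smul_comm (faceCoeff i.1 σ.arrows) ((-1 : ℤ) ^ (i.2.2.index : ℕ)),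
    smul_comm (faceCoeff i.1 σ.arrows) γ.sign, smul_smul, smul_smul, mul_neg, neg_mul, neg_smul]

/-- Paths are grouped by their first downward arrow. From a critical face the path can only stop,
from the lower cell of a pair it must go up, and from the upper cell of a pair it cannot contribute.
The facet matched with `σ` is not available. -/
theorem IsAcyclic.flowVal_eq (hM : M.IsAcyclic) (hC : IsAcyclicCategory (PathCat k S))
    [∀ n, Finite (Cell k S n)] (σ : Cell k S (n + 1)) :
    M.flowVal σ = ∑ i : Fin (n + 2), if M.pair σ (faceCell hC i σ) then 0 else
      ((-1 : ℤ) ^ (i : ℕ)) • faceCoeff i σ.arrows •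
        (M.critIncl (faceCell hC i σ) 1 - M.upVal (faceCell hC i σ)) := by
  have := fun τ σ => hM.finite_gradientPath hC (n := n) τ σ
  have := fun τ σ => Fintype.ofFinite (M.GradientPath (n := n) τ σ)
  have := Fintype.ofFinite {τ : Cell k S n // M.IsCritical τ}
  have hval : ∀ σ : Cell k S (n + 1), M.flowVal σ =
      ∑ τ : {τ : Cell k S n // M.IsCritical τ}, ∑ γ : M.GradientPath τ.1 σ, γ.weight := by
    intro σ
    rw [flowVal, finsum_eq_sum_of_fintype]
    exact Finset.sum_congr rfl fun τ _ => finsum_eq_sum_of_fintype _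
  have hsplit : ∀ τ : Cell k S n, ∑ γ : M.GradientPath τ σ, γ.weight =
      ∑ i : Fin (n + 2),
        ((if faceCell hC i σ = τ ∧ ¬ M.pair σ τ then
          ((-1 : ℤ) ^ (i : ℕ)) • faceCoeff i σ.arrows • M.critIncl τ 1 else 0) -
        (if h : ¬ M.pair σ (faceCell hC i σ) ∧ M.IsBottom (faceCell hC i σ) then
          ((-1 : ℤ) ^ (i : ℕ)) • faceCoeff i σ.arrows •
            ((-1 : ℤ) ^ (h.2.index : ℕ)) • ∑ γ : M.GradientPath τ h.2.top, γ.weight else 0)) := by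
    intro τ
    rw [← (Equiv.ofBijective _ (gradientPathOf_bijective (M := M) hC τ σ)).sum_comp,
      Fintype.sum_sum_type, Fintype.sum_sigma]
    simp only [Equiv.ofBijective_apply, weight_last, weight_step, Finset.sum_neg_distrib,
      ← Finset.smul_sum]
    rw [sum_subtype_eq_sum_dite, sum_subtype_eq_sum_dite, Finset.sum_sub_distrib, sub_eq_add_neg]
    rfl
  rw [hval]
  simp only [hsplit]
  rw [Finset.sum_comm]
  refine Finset.sum_congr rfl fun i _ => ?_
  rw [Finset.sum_sub_distrib]
  by_cases hp : M.pair σ (faceCell hC i σ)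
  · rw [if_pos hp, Finset.sum_eq_zero, Finset.sum_eq_zero, sub_zero]
    · intro τ _
      rw [dif_neg fun h => h.1 hp]
    · intro τ _
      rw [if_neg]
      rintro ⟨h, h'⟩
      exact h' (h ▸ hp)
  · rw [if_neg hp, smul_sub, smul_sub]
    congr 1
    · by_cases hc : M.IsCritical (faceCell hC i σ)
      · rw [Finset.sum_eq_single ⟨faceCell hC i σ, hc⟩, if_pos ⟨rfl, hp⟩]
        · rintro τ _ hτ
          rw [if_neg]
          rintro ⟨h, -⟩
          exact hτ (Subtype.ext h.symm)
        · exact fun h => absurd (Finset.mem_univ _) h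
      · rw [M.critIncl_of_not_critical hc, smul_zero, smul_zero, Finset.sum_eq_zero]
        intro τ _
        rw [if_neg]
        rintro ⟨h, -⟩
        exact hc (h ▸ τ.2)
    · by_cases hb : M.IsBottom (faceCell hC i σ)
      · rw [upVal, dif_pos hb, hval, Finset.smul_sum, Finset.smul_sum, Finset.smul_sum]
        exact Finset.sum_congr rfl fun τ _ => by rw [dif_pos ⟨hp, hb⟩]
      · rw [upVal, dif_neg hb, smul_zero, smul_zero, Finset.sum_eq_zero]
        intro τ _
        rw [dif_neg fun h => hb h.2]

/-! ### The splitting given by an acyclic internal matching -/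

theorem cellularD_incl_one (hC : IsAcyclicCategory (PathCat k S)) (σ : Cell k S (n + 1)) :
    cellularD k S n (incl σ.arrows 1) = ∑ i : Fin (n + 2), ((-1 : ℤ) ^ (i : ℕ)) •
      faceCoeff i σ.arrows • incl (faceCell hC i σ).arrows 1 := by
  rw [cellularD_incl hC]
  refine Finset.sum_congr rfl fun i _ => ?_
  rw [one_mul, incl_eq_smul]
  rfl

theorem flowMap_upMap_incl (hM' : M.IsInternal) (τ : Cell k S n) :
    M.flowMap n (M.upMap n (incl τ.arrows 1)) = endIdem τ.arrows • M.upVal τ := by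
  by_cases h : M.IsBottom τ
  · rw [M.upMap_incl hM' h, map_zsmul, flowMap_incl, hM'.endIdem_eq h.pair, upVal, dif_pos h,
      smul_comm]
  · rw [M.upMap_incl_of_not h, map_zero, upVal, dif_neg h, smul_zero]

theorem smul_sub_smul_smul {R X : Type*} [Ring R] [AddCommGroup X] [Module R X] (r : R) {e : R}
    {a : X} (b : X) (h : e • a = a) : r • a - r • e • b = r • e • (a - b) := by
  rw [smul_sub e, h, smul_sub]

/-- The sum is the one of `flowVal_eq`, except that a facet matched with `σ` is not left out. -/
theorem critπ_d_sub_flowMap_upMap_d (hM' : M.IsInternal) (hC : IsAcyclicCategory (PathCat k S))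
    (σ : Cell k S (n + 1)) :
    M.critπ n (cellularD k S n (incl σ.arrows 1)) -
        M.flowMap n (M.upMap n (cellularD k S n (incl σ.arrows 1))) =
      endIdem σ.arrows • ∑ i : Fin (n + 2), ((-1 : ℤ) ^ (i : ℕ)) • faceCoeff i σ.arrows •
        (M.critIncl (faceCell hC i σ) 1 - M.upVal (faceCell hC i σ)) := by
  rw [cellularD_incl_one hC, map_sum, map_sum, map_sum, ← Finset.sum_sub_distrib, Finset.smul_sum]
  refine Finset.sum_congr rfl fun i _ => ?_
  rw [map_zsmul, map_zsmul, map_zsmul, map_smul, map_smul, map_smul, critπ_incl,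
    flowMap_upMap_incl hM', ← zsmul_sub, smul_comm (endIdem σ.arrows)]
  refine congrArg (((-1 : ℤ) ^ (i : ℕ)) • ·) ((smul_sub_smul_smul _ _
    (M.endIdem_smul_critIncl_one (faceCell hC i σ))).trans ?_)
  rw [smul_smul, smul_smul]
  exact congrArg (· • _) (endIdem_mul_faceCoeff i σ.arrows).symm

/-- If `σ` is not an upper cell, no face is excluded and this is the recursion. If it is, both sides
vanish. -/
theorem IsAcyclic.flowMap_sub (hM : M.IsAcyclic) (hM' : M.IsInternal)
    (hC : IsAcyclicCategory (PathCat k S)) [∀ n, Finite (Cell k S n)]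
    (x : CellularModule k S (n + 1)) :
    M.flowMap n x - M.flowMap n (M.topProj (n + 1) x) =
      M.critπ n (cellularD k S n x) - M.flowMap n (M.upMap n (cellularD k S n x)) := by
  suffices h : M.flowMap n - (M.flowMap n).comp (M.topProj (n + 1)) =
      (M.critπ n).comp (cellularD k S n) -
        ((M.flowMap n).comp (M.upMap n)).comp (cellularD k S n) from LinearMap.congr_fun h x
  refine cellular_hom_ext fun σ => ?_
  change M.flowMap n (incl σ.arrows 1) - M.flowMap n (M.topProj (n + 1) (incl σ.arrows 1)) =
    M.critπ n (cellularD k S n (incl σ.arrows 1)) -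
      M.flowMap n (M.upMap n (cellularD k S n (incl σ.arrows 1)))
  rw [critπ_d_sub_flowMap_upMap_d hM' hC, topProj_incl, flowMap_incl]
  have hflow := hM.flowVal_eq hC σ
  by_cases ht : M.IsTop σ
  · rw [if_pos ht, flowMap_incl, sub_self]
    obtain ⟨τ, hτ⟩ := ht
    obtain ⟨j, hj⟩ := M.facet hτ
    obtain rfl := eq_faceCell hC hj
    have hb : M.IsBottom (faceCell hC j σ) := ⟨σ, hτ⟩
    have hσ : hb.top = σ := M.top_unique hb.pair hτ
    have hidx : hb.index = j := face_injective hC (σ := σ) (by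
      have := hb.face_index
      rw [hj]
      convert this
      exact hσ.symm)
    have hj' : ∀ i, M.pair σ (faceCell hC i σ) ↔ i = j := fun i => by
      constructor
      · intro h
        exact face_injective hC (congrArg Cell.arrows (M.bottom_unique h hτ))
      · rintro rfl
        exact hτ
    simp only [hj'] at hflow
    -- The matched face has coefficient one and its two equal signs cancel, so it contributes minus
    -- the flow of `σ`; the other faces sum to the flow of `σ`.
    have hsum : ∑ i : Fin (n + 2), ((-1 : ℤ) ^ (i : ℕ)) • faceCoeff i σ.arrows •
        (M.critIncl (faceCell hC i σ) 1 - M.upVal (faceCell hC i σ)) = 0 := by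
      rw [← Finset.add_sum_erase _ _ (Finset.mem_univ j), hM'.faceCoeff_eq_one hC hτ hj,
        M.critIncl_of_not_critical (fun h => h.2 hb), upVal, dif_pos hb, hσ, hidx, one_smul,
        zero_sub, smul_neg, smul_smul, ← mul_pow, neg_one_mul, neg_neg, one_pow, one_smul,
        neg_add_eq_zero]
      rw [hflow, ← Finset.add_sum_erase _ _ (Finset.mem_univ j), if_pos rfl, zero_add]
      refine Finset.sum_congr rfl fun i hi => ?_
      rw [if_neg (Finset.ne_of_mem_erase hi)]
    rw [hsum, smul_zero]
  · rw [if_neg ht, map_zero, sub_zero, hflow]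
    congr 1
    refine Finset.sum_congr rfl fun i _ => ?_
    rw [if_neg fun h => ht (M.isTop_of_pair h)]

/-- Going up from a lower cell `τ` and down to the matched face returns `τ` with sign `+1`, which
the subtracted `B` removes. The remaining faces are reachable from `τ`. -/
theorem isNilpotent_pert (hM : M.IsAcyclic) (hM' : M.IsInternal)
    (hC : IsAcyclicCategory (PathCat k S)) [Finite (Cell k S n)] :
    IsNilpotent (M.bottomProj n ∘ₗ cellularD k S n ∘ₗ M.upMap n - M.bottomProj n :
      Module.End (Env k S) (CellularModule k S n)) := by
  refine isNilpotent_of_reach hM _ fun τ => ?_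
  change M.bottomProj n (cellularD k S n (M.upMap n (incl τ.arrows 1))) -
    M.bottomProj n (incl τ.arrows 1) ∈ _
  by_cases hb : M.IsBottom τ
  · have hc : faceCell hC hb.index hb.top = τ := Cell.ext hb.face_index
    rw [M.upMap_incl hM' hb, map_zsmul, map_zsmul, cellularD_incl_one hC, map_sum,
      Finset.smul_sum, ← Finset.add_sum_erase _ _ (Finset.mem_univ hb.index), hc,
      hM'.faceCoeff_eq_one hC hb.pair hb.face_index, one_smul, map_zsmul, smul_smul, ← mul_pow,
      neg_one_mul, neg_neg, one_pow, one_smul, add_sub_cancel_left]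
    refine Submodule.sum_mem _ fun i hi => ?_
    have hi' : ¬ M.pair hb.top (faceCell hC i hb.top) := fun h =>
      Finset.ne_of_mem_erase hi (face_injective hC
        (congrArg Cell.arrows ((M.bottom_unique h hb.pair).trans hc.symm)))
    rw [map_zsmul, map_smul, bottomProj_incl]
    refine zsmul_mem (zsmul_mem (Submodule.smul_mem _ _ ?_) _) _
    split_ifs with h
    · exact Submodule.subset_span ⟨_, reach_of_pair_of_face hC hb.pair hi', rfl⟩
    · exact zero_mem _
  · rw [M.upMap_incl_of_not hb, bottomProj_incl, if_neg hb, map_zero, map_zero, sub_zero]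
    exact zero_mem _

theorem exists_upMap (hM' : M.IsInternal) (x : CellularModule k S (n + 1)) :
    ∃ y, M.upMap n y = M.topProj (n + 1) x := by
  -- Passing to the quotient by the range turns the existence statement into an equality of linear
  -- maps, which can be tested on generators.
  suffices h : ((LinearMap.range (M.upMap n)).mkQ).comp (M.topProj (n + 1)) = 0 from
    (Submodule.Quotient.mk_eq_zero _).1 (LinearMap.congr_fun h x)
  refine cellular_hom_ext fun σ => ?_
  rw [LinearMap.comp_apply, LinearMap.zero_apply, topProj_incl]
  refine (Submodule.Quotient.mk_eq_zero _).2 ?_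
  split_ifs with h
  · obtain ⟨τ, hτ⟩ := h
    have hb : M.IsBottom τ := ⟨σ, hτ⟩
    refine ⟨((-1 : ℤ) ^ (hb.index : ℕ)) • incl τ.arrows 1, ?_⟩
    rw [map_zsmul, M.upMap_incl hM' hb, smul_smul, ← mul_pow, neg_one_mul, neg_neg, one_pow,
      one_smul, M.top_unique hb.pair hτ]
  · exact zero_mem _

/-- The splitting of the cellular complex given by an acyclic internal matching. -/
def morseSplitting (hM : M.IsAcyclic) (hM' : M.IsInternal)
    (hC : IsAcyclicCategory (PathCat k S)) [∀ n, Finite (Cell k S n)] :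
    MorseSplitting (R := Env k S) (CellularModule k S) M.MorseModule (cellularD k S) where
  ι := M.critι
  π := M.critπ
  T := M.topProj
  B := M.bottomProj
  up := M.upMap
  flow := M.flowMap
  π_ι n x := by
    suffices h : (M.critπ n).comp (M.critι n) = LinearMap.id from LinearMap.congr_fun h x
    refine M.morse_hom_ext fun σ h => ?_
    rw [LinearMap.comp_apply, M.critι_critIncl h, critπ_incl, LinearMap.id_apply]
  sum n x := by
    suffices h : (M.critι n).comp (M.critπ n) + M.topProj n + M.bottomProj n = LinearMap.id from
      LinearMap.congr_fun h x
    refine cellular_hom_ext fun σ => ?_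
    rw [LinearMap.add_apply, LinearMap.add_apply, LinearMap.comp_apply, critπ_incl, topProj_incl,
      bottomProj_incl, LinearMap.id_apply]
    by_cases hb : M.IsBottom σ
    · rw [if_pos hb, if_neg (M.not_isTop_of_isBottom hb),
        M.critIncl_of_not_critical fun h => h.2 hb, map_zero, zero_add, zero_add]
    · by_cases ht : M.IsTop σ
      · rw [if_neg hb, if_pos ht, M.critIncl_of_not_critical fun h => h.1 ht, map_zero, zero_add,
          add_zero]
      · rw [if_neg hb, if_neg ht, M.critι_critIncl ⟨ht, hb⟩, add_zero, add_zero]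
  π_T n x := by
    suffices h : (M.critπ n).comp (M.topProj n) = 0 from LinearMap.congr_fun h x
    refine cellular_hom_ext fun σ => ?_
    rw [LinearMap.comp_apply, topProj_incl]
    split_ifs with h
    · rw [critπ_incl, M.critIncl_of_not_critical fun h' => h'.1 h]
      rfl
    · exact map_zero _
  T_T n x := by
    suffices h : (M.topProj n).comp (M.topProj n) = M.topProj n from LinearMap.congr_fun h x
    refine cellular_hom_ext fun σ => ?_
    rw [LinearMap.comp_apply, topProj_incl]
    split_ifs with h
    · rw [topProj_incl, if_pos h]
    · exact map_zero _
  B_B n x := by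
    suffices h : (M.bottomProj n).comp (M.bottomProj n) = M.bottomProj n from
      LinearMap.congr_fun h x
    refine cellular_hom_ext fun σ => ?_
    rw [LinearMap.comp_apply, bottomProj_incl]
    split_ifs with h
    · rw [bottomProj_incl, if_pos h]
    · exact map_zero _
  B_T n x := by
    suffices h : (M.bottomProj n).comp (M.topProj n) = 0 from LinearMap.congr_fun h x
    refine cellular_hom_ext fun σ => ?_
    rw [LinearMap.comp_apply, topProj_incl]
    split_ifs with h
    · rw [bottomProj_incl, if_neg fun h' => M.not_isTop_of_isBottom h' h]
      rfl
    · exact map_zero _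
  T_ι n x := by
    suffices h : (M.topProj n).comp (M.critι n) = 0 from LinearMap.congr_fun h x
    refine M.morse_hom_ext fun σ h => ?_
    rw [LinearMap.comp_apply, M.critι_critIncl h, topProj_incl, if_neg h.1]
    rfl
  B_ι n x := by
    suffices h : (M.bottomProj n).comp (M.critι n) = 0 from LinearMap.congr_fun h x
    refine M.morse_hom_ext fun σ h => ?_
    rw [LinearMap.comp_apply, M.critι_critIncl h, bottomProj_incl, if_neg h.2]
    rfl
  up_B n x := by
    suffices h : (M.upMap n).comp (M.bottomProj n) = M.upMap n from LinearMap.congr_fun h x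
    refine cellular_hom_ext fun σ => ?_
    rw [LinearMap.comp_apply, bottomProj_incl]
    split_ifs with h
    · rfl
    · rw [M.upMap_incl_of_not h, map_zero]
  T_up n x := by
    suffices h : (M.topProj (n + 1)).comp (M.upMap n) = M.upMap n from LinearMap.congr_fun h x
    refine cellular_hom_ext fun σ => ?_
    rw [LinearMap.comp_apply]
    by_cases h : M.IsBottom σ
    · rw [M.upMap_incl hM' h, map_zsmul, topProj_incl, if_pos (M.isTop_of_pair h.pair)]
    · rw [M.upMap_incl_of_not h, map_zero]
  exists_up n x := exists_upMap hM' x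
  B_zero x := by
    suffices h : M.bottomProj 0 = 0 from LinearMap.congr_fun h x
    refine cellular_hom_ext fun σ => ?_
    rw [bottomProj_incl, if_neg (hM'.vertex_unmatched σ).2]
    rfl
  T_zero x := by
    suffices h : M.topProj 0 = 0 from LinearMap.congr_fun h x
    refine cellular_hom_ext fun σ => ?_
    rw [topProj_incl, if_neg (hM'.vertex_unmatched σ).1]
    rfl
  flow_sub n x := hM.flowMap_sub hM' hC x
  nilpotent n := isNilpotent_pert hM hM' hC

/-- Finiteness of cells and gradient paths makes both nested `finsum`s honest sums; termwise, only
the placement of the idempotents differs. -/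
theorem morseD_eq_δ (hM : M.IsAcyclic) (hM' : M.IsInternal)
    (hC : IsAcyclicCategory (PathCat k S)) [∀ n, Finite (Cell k S n)] (n : ℕ) :
    M.morseD n = (morseSplitting hM hM' hC).δ n := by
  have := fun τ σ => hM.finite_gradientPath hC (n := n) τ σ
  have := fun τ σ => Fintype.ofFinite (M.GradientPath (n := n) τ σ)
  have := Fintype.ofFinite {τ : Cell k S n // M.IsCritical τ}
  refine M.morse_hom_ext fun σ h => ?_
  change _ = M.flowMap n (M.critι (n + 1) (M.critIncl σ 1))
  rw [M.critι_critIncl h, flowMap_incl, M.critIncl_of_critical h, morseD, DirectSum.toModule_lof,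
    flowVal, finsum_eq_sum_of_fintype, finsum_eq_sum_of_fintype, LinearMap.sum_apply,
    Finset.smul_sum]
  refine Finset.sum_congr rfl fun τ _ => ?_
  rw [finsum_eq_sum_of_fintype, finsum_eq_sum_of_fintype, LinearMap.sum_apply, Finset.smul_sum]
  refine Finset.sum_congr rfl fun γ _ => ?_
  have hs : endIdem σ.arrows • M.critIncl τ.1 (Env.tmul γ.left γ.right) =
      M.critIncl τ.1 (endIdem σ.arrows * Env.tmul γ.left γ.right) := by
    rw [← smul_eq_mul, map_smul]
  rw [LinearMap.smul_apply, GradientPath.weight, smul_comm (endIdem σ.arrows), hs,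
    M.critIncl_of_critical τ.2]
  congr 1
  rw [LinearMap.comp_apply]
  congr 1
  refine Subtype.ext ?_
  change 1 * endIdem σ.arrows * (Env.tmul γ.left γ.right * endIdem τ.1.arrows) =
    endIdem σ.arrows * Env.tmul γ.left γ.right * endIdem τ.1.arrows
  rw [one_mul, mul_assoc]

end Matching

/-! ### Augmentations -/

section Augmentation

variable {R : Type u} [Ring R]

/-- In degree `0` a quasi-isomorphism means a surjective augmentation with kernel the image of `d`;
in higher degrees the target is exact, so the source must be. -/
theorem quasiIso_toSingle₀_of_exact (C : ℕ → ModuleCat.{v} R) (d : ∀ n, C (n + 1) ⟶ C n)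
    (sq : ∀ n, d (n + 1) ≫ d n = 0) (X : ModuleCat.{v} R) (ε : C 0 ⟶ X)
    (hε : (ChainComplex.of C d sq).d 1 0 ≫ ε = 0) (hsurj : Function.Surjective ε)
    (hzero : ∀ z : C 0, ε z = 0 → ∃ y, d 0 y = z)
    (hsucc : ∀ n (z : C (n + 1)), d n z = 0 → ∃ y, d (n + 1) y = z) :
    QuasiIso (((ChainComplex.of C d sq).toSingle₀Equiv X).symm ⟨ε, hε⟩) := by
  refine ⟨fun n => ?_⟩
  cases n with
  | zero =>
    have hf : (((ChainComplex.of C d sq).toSingle₀Equiv X).symm ⟨ε, hε⟩).f 0 = ε :=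
      ChainComplex.toSingle₀Equiv_symm_apply_f_zero (C := ChainComplex.of C d sq) (X := X) ε hε
    have hepi : Epi ((((ChainComplex.of C d sq).toSingle₀Equiv X).symm ⟨ε, hε⟩).f 0) := by
      rw [hf]
      exact (ModuleCat.epi_iff_surjective ε).2 hsurj
    rw [ChainComplex.quasiIsoAt₀_iff, ShortComplex.quasiIso_iff_of_zeros' _ rfl rfl rfl]
    constructor
    · refine (ShortComplex.moduleCat_exact_iff _).2 fun z hz => ?_
      obtain ⟨y, hy⟩ := hzero z ((congrArg (fun f : C 0 ⟶ X => f z) hf).symm.trans hz)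
      exact ⟨y, (congrArg (fun f : C 1 ⟶ C 0 => f y) (chainComplex_of_d_succ C d sq 0)).trans hy⟩
    · exact hepi
  | succ n =>
    rw [quasiIsoAt_iff_exactAt' (hL := ChainComplex.exactAt_succ_single_obj ..),
      HomologicalComplex.exactAt_iff' _ (n + 2) (n + 1) n (by simp) (by simp)]
    refine (ShortComplex.moduleCat_exact_iff _).2 fun z hz => ?_
    have h1 := chainComplex_of_d_succ C d sq n
    have h2 := chainComplex_of_d_succ C d sq (n + 1)
    obtain ⟨y, hy⟩ := hsucc n z ((congrArg (fun f : C (n + 1) ⟶ C n => f z) h1).symm.trans hz)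
    exact ⟨y, (congrArg (fun f : C (n + 2) ⟶ C (n + 1) => f y) h2).trans hy⟩

end Augmentation

/-! ### Projectivity -/

section Projective

variable {k : Type w} [CommRing k] {Q : Type u} [Quiver.{v} Q] [Fintype Q] {S : PathRelations Q}

/-- Right multiplication by the idempotent retracts the enveloping algebra onto the left ideal it
generates. -/
instance projective_boxProj (a b : Q) : Module.Projective (Env k S) (boxProj k S a b) :=
  Module.Projective.of_split (boxProj k S a b).subtype
    (LinearMap.toSpanSingleton (Env k S) (boxProj k S a b)
      ⟨envIdem k S a b, Submodule.subset_span rfl⟩)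
    (LinearMap.ext fun y => Subtype.ext (mul_envIdem_of_mem y.2))

theorem Matching.projective_morseComplex (M : Matching k S)
    (hD : ∀ n, (M.morseD n).comp (M.morseD (n + 1)) = 0) (n : ℕ) :
    Projective ((M.morseComplex hD).X n) :=
  (IsProjective.iff_projective (R := Env k S) (P := M.MorseModule n)).1 inferInstance

end Projective

/-! ### Comparison of the cellular and Morse complexes over the diagonal bimodule -/

section Main

theorem ofHom_comp_ofHom_eq_zero {R : Type u} [Ring R] {X Y Z : Type v} [AddCommGroup X]
    [AddCommGroup Y] [AddCommGroup Z] [Module R X] [Module R Y] [Module R Z] {f : Y →ₗ[R] Z}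
    {g : X →ₗ[R] Y} (h : f.comp g = 0) : ModuleCat.ofHom g ≫ ModuleCat.ofHom f = 0 := by
  rw [← ModuleCat.ofHom_comp, h]
  rfl

open scoped Classical

variable {k : Type w} [CommRing k] {Q : Type u} [Quiver.{v} Q] [Fintype Q] {S : PathRelations Q}

theorem cellularAug_surjective : Function.Surjective (cellularAug k S) := fun x =>
  ⟨contractionAug k S x, cellularAug_contractionAug x⟩

theorem cellularComplex_d_comp_cellularAug (hC : IsAcyclicCategory (PathCat k S))
    (hC' : ∀ n, (cellularD k S n).comp (cellularD k S (n + 1)) = 0) :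
    (cellularComplex k S hC').d 1 0 ≫ ModuleCat.ofHom (cellularAug k S) = 0 :=
  (congrArg (· ≫ ModuleCat.ofHom (cellularAug k S))
    (chainComplex_of_d_succ _ _ (fun n => ofHom_comp_ofHom_eq_zero (hC' n)) 0)).trans
    (ofHom_comp_ofHom_eq_zero (cellularAug_comp_cellularD hC))

theorem quasiIso_cellularAug (hC : IsAcyclicCategory (PathCat k S))
    (hC' : ∀ n, (cellularD k S n).comp (cellularD k S (n + 1)) = 0) :
    QuasiIso (((cellularComplex k S hC').toSingle₀Equiv
      (ModuleCat.of (Env k S) (QuotAlg k S))).symm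
        ⟨ModuleCat.ofHom (cellularAug k S), cellularComplex_d_comp_cellularAug hC hC'⟩) :=
  quasiIso_toSingle₀_of_exact (fun n => ModuleCat.of (Env k S) (CellularModule k S n))
    (fun n => ModuleCat.ofHom (cellularD k S n)) (fun n => ofHom_comp_ofHom_eq_zero (hC' n))
    (ModuleCat.of (Env k S) (QuotAlg k S)) (ModuleCat.ofHom (cellularAug k S))
    (cellularComplex_d_comp_cellularAug hC hC')
    cellularAug_surjective (fun _ hz => cellularAug_exact hC hz) fun _ _ hz => cellularD_exact hC hz

theorem augmentation_critπ {M : Matching k S} (hM' : M.IsInternal) :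
    M.augmentation ∘ₗ M.critπ 0 = cellularAug k S := by
  refine cellular_hom_ext fun σ => ?_
  rw [LinearMap.comp_apply, Matching.critπ_incl,
    M.critIncl_of_critical (hM'.vertex_unmatched σ), Matching.augmentation,
    DirectSum.toModule_lof, cellularAug_incl, one_smul]
  change (1 * endIdem σ.arrows) • (1 : QuotAlg k S) = _
  rw [one_mul]
  refine (Env.tmul_smul _ _ _).trans ?_
  rw [mul_one]
  exact idem_mul_idem _

theorem exists_hom_morseComplex {M : Matching k S} (hM : M.IsAcyclic) (hM' : M.IsInternal)
    (hC : IsAcyclicCategory (PathCat k S)) [∀ n, Finite (Cell k S n)]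
    (hC' : ∀ n, (cellularD k S n).comp (cellularD k S (n + 1)) = 0)
    (hD : ∀ n, (M.morseD n).comp (M.morseD (n + 1)) = 0) :
    ∃ g : cellularComplex k S hC' ⟶ M.morseComplex hD, QuasiIso g ∧
      g.f 0 = ModuleCat.ofHom (M.critπ 0) := by
  -- The differential is generalized first because the type of `g` depends on it; the equality with
  -- the abstract Morse differential can then be substituted.
  suffices h : ∀ (δ : ∀ n, M.MorseModule (n + 1) →ₗ[Env k S] M.MorseModule n),
      δ = (Matching.morseSplitting hM hM' hC).δ →
      ∀ hδ : ∀ n, ModuleCat.ofHom (δ (n + 1)) ≫ ModuleCat.ofHom (δ n) = 0,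
      ∃ g : cellularComplex k S hC' ⟶ ChainComplex.of
        (fun n => ModuleCat.of (Env k S) (M.MorseModule n)) (fun n => ModuleCat.ofHom (δ n)) hδ,
        QuasiIso g ∧ g.f 0 = ModuleCat.ofHom (M.critπ 0) from
    h M.morseD (funext (Matching.morseD_eq_δ hM hM' hC))
      fun n => ofHom_comp_ofHom_eq_zero (hD n)
  rintro _ rfl hδ
  have hC'' := fun n => ofHom_comp_ofHom_eq_zero (hC' n)
  refine ⟨(Matching.morseSplitting hM hM' hC).projHom hC'' hδ,
    (Matching.morseSplitting hM hM' hC).quasiIso_projHom hC'' hδ, ?_⟩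
  exact congrArg ModuleCat.ofHom
    (LinearMap.ext fun x => (Matching.morseSplitting hM hM' hC).proj_zero x)

end Main

end HomotopyPath

end

theorem mainTheorem4 {k : Type*} [CommRing k] [IsNoetherianRing k]
    {Q : Type*} [Quiver Q] [Fintype Q] [∀ a b : Q, Finite (a ⟶ b)] (hQ : IsAcyclicQuiver Q)
    (S : PathRelations Q) (hA : IsHPA k S)
    (M : Matching k S) (hM : M.IsAcyclic) (hM' : M.IsInternal) :
    ∃ (hC : ∀ n, (cellularD k S n).comp (cellularD k S (n + 1)) = 0)
      (hD : ∀ n, (M.morseD n).comp (M.morseD (n + 1)) = 0),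
      (∃ g : cellularComplex k S hC ⟶ M.morseComplex hD, QuasiIso g) ∧
      (∀ n, Projective ((M.morseComplex hD).X n)) ∧
      ∃ hm : (M.morseComplex hD).d 1 0 ≫ ModuleCat.ofHom M.augmentation = 0,
        QuasiIso (((M.morseComplex hD).toSingle₀Equiv
          (ModuleCat.of (Env k S) (QuotAlg k S))).symm ⟨ModuleCat.ofHom M.augmentation, hm⟩) := by

  have hC := hQ.pathCat (k := k) (S := S)
  have := hQ.finite_cell (k := k) (S := S)
  let m := Matching.morseSplitting hM hM' hC
  have hCC := cellularD_comp_cellularD (k := k) (S := S) hC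
  have hDD : ∀ n, (M.morseD n).comp (M.morseD (n + 1)) = 0 := fun n => by
    rw [Matching.morseD_eq_δ hM hM' hC, Matching.morseD_eq_δ hM hM' hC]
    exact LinearMap.ext fun x => m.δ_δ (fun n x => LinearMap.congr_fun (hCC n) x) n x
  obtain ⟨g, hg, hg0⟩ := exists_hom_morseComplex hM hM' hC hCC hDD
  refine ⟨hCC, hDD, ⟨g, hg⟩, M.projective_morseComplex hDD, ?_⟩
  have hgε : g.f 0 ≫ ModuleCat.ofHom M.augmentation = ModuleCat.ofHom (cellularAug k S) := by
    rw [hg0]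
    exact congrArg ModuleCat.ofHom (augmentation_critπ hM')
  have hmD : M.augmentation.comp (M.morseD 0) = 0 := by
    rw [Matching.morseD_eq_δ hM hM' hC]
    refine LinearMap.ext fun x => ?_
    -- The Morse projection is a surjective chain map compatible with the augmentations, so the
    -- claim reduces to the cellular complex.
    obtain ⟨y, rfl⟩ : ∃ y, m.proj 1 y = x := ⟨_, m.proj_ι 1 x⟩
    have h1 := m.δ_proj (fun n x => LinearMap.congr_fun (hCC n) x) 0 y
    have h2 := m.proj_zero (cellularD k S 0 y)
    have h3 := LinearMap.congr_fun (augmentation_critπ hM') (cellularD k S 0 y)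
    have h4 := LinearMap.congr_fun (cellularAug_comp_cellularD (k := k) (S := S) hC) y
    exact ((congrArg M.augmentation (h1.trans h2)).trans h3).trans h4
  have hm : (M.morseComplex hDD).d 1 0 ≫ ModuleCat.ofHom M.augmentation = 0 := by
    exact (congrArg (· ≫ ModuleCat.ofHom M.augmentation)
      (chainComplex_of_d_succ _ _ (fun n => ofHom_comp_ofHom_eq_zero (hDD n)) 0)).trans
      (ofHom_comp_ofHom_eq_zero hmD)
  refine ⟨hm, ?_⟩
  -- A map to a complex concentrated in degree `0` is determined by its degree `0` component, so
  -- `hgε` suffices. Since `g` and the composite are quasi-isomorphisms, so is the Morse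
  -- augmentation.
  have hcomp : g ≫ ((M.morseComplex hDD).toSingle₀Equiv _).symm
      ⟨ModuleCat.ofHom M.augmentation, hm⟩ =
      ((cellularComplex k S hCC).toSingle₀Equiv _).symm
        ⟨ModuleCat.ofHom (cellularAug k S), cellularComplex_d_comp_cellularAug hC hCC⟩ := by
    refine ((cellularComplex k S hCC).toSingle₀Equiv _).injective (Subtype.ext ?_)
    rw [Equiv.apply_symm_apply]
    refine Eq.trans ?_ hgε
    exact congrArg (g.f 0 ≫ ·) (ChainComplex.toSingle₀Equiv_symm_apply_f_zero _ hm)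
  have : QuasiIso (g ≫ ((M.morseComplex hDD).toSingle₀Equiv _).symm
      ⟨ModuleCat.ofHom M.augmentation, hm⟩) := hcomp ▸ quasiIso_cellularAug hC hCC
  exact quasiIso_of_comp_left g _
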